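/- Let $\alpha,\beta\in\mathbb C$ with $\|\alpha\|\ge\|\beta\|>1$. Fix logarithms $\log\alpha=\log\|\alpha\|+i\arg\alpha$ and $\log\beta=\log\|\beta\|+i\arg\beta$ (any branches), let $S^1=\mathbb R/2\pi\mathbb Z$ and $S^3=\{(\xi_1,\xi_2)\in\mathbb C^2:\|\xi_1\|^2+\|\xi_2\|^2=1\}$. Let $J_{\alpha,\beta}$ be the complex structure on $S^1\times S^3$ obtained from the Hopf surface $(\mathbb C^2\setminus 0)/\langle(z_1,z_2)\mapsto(\alpha z_1,\beta z_2)\rangle$ through the diffeomorphism $F(\theta,\xi_1,\xi_2)=[e^{\theta\log\alpha/2\pi}\xi_1,\,e^{\theta\log\beta/2\pi}\xi_2]$. For a smooth positive function $h$ on $S^1$ let $g^h$ be the Hermitian metric on $(S^1\times S^3,J_{\alpha,\beta})$ with matrix $$\begin{pmatrix}\dfrac{\pi h}{R^2}+\dfrac{\|\xi_1\|^2\|\xi_2\|^2L^2}{R^3}&\dfrac{i\xi_1\xi_2L}{R^2}\\ \dfrac{\overline{i\xi_1\xi_2}L}{R^2}&\dfrac1R\end{pmatrix},\qquad R=\|\xi_1\|^2\log\|\alpha\|+\|\xi_2\|^2\log\|\beta\|,\quad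 L=\log\frac{\|\alpha\|}{\|\beta\|},$$ in the complex basis $e_2=(i\xi_1,i\xi_2)$, $e_3=(-\bar\xi_2,\bar\xi_1)$ of $T(S^1\times S^3)$. Let $\Omega$ be its fundamental form, $\omega$ its Lee form (that is, the $1$-form with $d\Omega=\omega\wedge\Omega$), $\mathcal F=\ker\omega$, and let $\mathcal E_{\alpha,\beta}$ be the foliation of $S^1\times S^3$ tangent to $\mathcal F^\perp\oplus J_{\alpha,\beta}\mathcal F^\perp$. (The leaf through a point consists of the points joined to it by $C^1$ curves tangent to this distribution.) A *saturated component* of $\mathcal E_{\alpha,\beta}$ is a minimal element, for inclusion, among the nonempty closed subsets of $S^1\times S^3$ that are unions of leaves. Consider the condition (R) there are integers $k,l,p,q$ with $k,q\neq0$ and $(p,q)=(l,k)=1$ such that $\dfrac{k\arg\alpha-l\arg\beta}{\pi}=\dfrac pq$ and $\dfrac{\log\|\alpha\|}{\log\|\beta\|}=\dfrac lk$. Then (R) is equivalent to the existence of integers $m,n$, not both zero, with $\alpha^m=\beta^n$. If (R) does not hold, then, for every $h$ as above, the saturated components of $\mathcal E_{\alpha,\beta}$ are exactly the following sets, of two kinds: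 1. $S^1\times\{(\xi_1,\xi_2)\in S^3:\xi_2=0\}$ and $S^1\times\{(\xi_1,\xi_2)\in S^3:\xi_1=0\}$; 2. $S^1\times T(\Xi_1,\Xi_2)$, for $(\Xi_1,\Xi_2)\in S^3$ with $\Xi_1\Xi_2\ne0$, where $T(\Xi_1,\Xi_2)=\{(\xi_1,\xi_2)\in S^3:\|\xi_1\|=\|\Xi_1\|,\ \|\xi_2\|=\|\Xi_2\|\}$. Moreover, in this case the closures of the leaves of $\mathcal E_{\alpha,\beta}$ are exactly these same sets. -/

import Mathlib

open scoped ContDiff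

namespace HopfFoliation

noncomputable section

/-- The circle, as the quotient of the real line by `θ ↦ θ + 2π`. -/
abbrev S1 : Type := AddCircle (2 * Real.pi)

/-- The unit sphere of `ℂ²`. -/
abbrev S3 : Type := {ξ : ℂ × ℂ // ‖ξ.1‖ ^ 2 + ‖ξ.2‖ ^ 2 = 1}

/-- The linear space `ℝ × ℂ²`, with points `(θ, ξ₁, ξ₂)`. It contains the covering `ℝ × S³` of
`S¹ × S³`. The tensors below are written in these linear coordinates and are used on `ℝ × S³`
only; the metric, the complex structure and the Lee form are `2π`-periodic in `θ`, so that they are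
tensors on `S¹ × S³`. -/
abbrev V : Type := ℝ × ℂ × ℂ

/-- The submanifold `ℝ × S³` of `ℝ × ℂ²`. -/
def OnCover (p : V) : Prop := ‖p.2.1‖ ^ 2 + ‖p.2.2‖ ^ 2 = 1

/-- The parallelization `(e₁, e₂, e₃, e₄)` of `S¹ × S³`, numbered from `0`: the unit field along
the circle, and `Q ↦ iQ`, `Q ↦ jQ`, `Q ↦ kQ` on the unit quaternions `Q`. -/
def frame (i : Fin 4) (p : V) : V :=
  ![((1 : ℝ), (0 : ℂ), (0 : ℂ)),
    ((0 : ℝ), Complex.I * p.2.1, Complex.I * p.2.2),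
    ((0 : ℝ), -(starRingEnd ℂ) p.2.2, (starRingEnd ℂ) p.2.1),
    ((0 : ℝ), -(Complex.I * (starRingEnd ℂ) p.2.2), Complex.I * (starRingEnd ℂ) p.2.1)] i

/-- The tangent space of `ℝ × S³` at `p`. -/
def tangent (p : V) : Submodule ℝ V := Submodule.span ℝ (Set.range fun i => frame i p)

/-- The map `F(θ, ξ) = (exp(θ log α / 2π) ξ₁, exp(θ log β / 2π) ξ₂)`, where `a = log α` and
`b = log β`. It restricts to a diffeomorphism of `ℝ × S³` onto `ℂ² ∖ 0` that carries
`θ ↦ θ + 2π` to `(z₁, z₂) ↦ (α z₁, β z₂)`. -/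
def F (a b : ℂ) (p : V) : ℂ × ℂ :=
  (Complex.exp ((p.1 : ℂ) * a / (2 * Real.pi)) * p.2.1,
    Complex.exp ((p.1 : ℂ) * b / (2 * Real.pi)) * p.2.2)

/-- The differential of `F` at `p`. The complex structure `J` of `S¹ × S³` is the one carried by
`F` to multiplication by `i`: for tangent vectors, `Y = J X` means `dF Y = i dF X`. -/
def dF (a b : ℂ) (p : V) : V →L[ℝ] ℂ × ℂ := fderiv ℝ (F a b) p

/-- The coordinates of the tangent vector `X` in the `J`-complex basis `(e₂, e₃)`: the pair
`(x₁, x₂)` of complex numbers such that `dF X = x₁ dF e₂ + x₂ dF e₃`. -/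
def coords (a b : ℂ) (p X : V) : Fin 2 → ℂ :=
  (!![(dF a b p (frame 1 p)).1, (dF a b p (frame 2 p)).1;
      (dF a b p (frame 1 p)).2, (dF a b p (frame 2 p)).2] : Matrix (Fin 2) (Fin 2) ℂ)⁻¹.mulVec
    ![(dF a b p X).1, (dF a b p X).2]

/-- `Re G = ‖ξ₁‖² log ‖α‖ + ‖ξ₂‖² log ‖β‖`. -/
def reG (a b : ℂ) (p : V) : ℝ := ‖p.2.1‖ ^ 2 * a.re + ‖p.2.2‖ ^ 2 * b.re

/-- The Hermitian matrix of the metric `g^h` in the complex basis `(e₂, e₃)`;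
here `a.re - b.re = log (‖α‖ / ‖β‖)`. -/
def metricMatrix (a b : ℂ) (h : ℝ → ℝ) (p : V) : Matrix (Fin 2) (Fin 2) ℂ :=
  !![((Real.pi * h p.1 / reG a b p ^ 2
        + ‖p.2.1‖ ^ 2 * ‖p.2.2‖ ^ 2 * (a.re - b.re) ^ 2 / reG a b p ^ 3 : ℝ) : ℂ),
      Complex.I * p.2.1 * p.2.2 * ((a.re - b.re : ℝ) : ℂ) / ((reG a b p ^ 2 : ℝ) : ℂ);
      (starRingEnd ℂ) (Complex.I * p.2.1 * p.2.2) * ((a.re - b.re : ℝ) : ℂ)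
        / ((reG a b p ^ 2 : ℝ) : ℂ),
      ((1 / reG a b p : ℝ) : ℂ)]

/-- The Hermitian form with that matrix, complex linear in `X` and antilinear in `Y`. -/
def herm (a b : ℂ) (h : ℝ → ℝ) (p X Y : V) : ℂ :=
  ∑ i, ∑ j, coords a b p X i * metricMatrix a b h p i j * (starRingEnd ℂ) (coords a b p Y j)

/-- The Riemannian metric `g^h`. -/
def metric (a b : ℂ) (h : ℝ → ℝ) (p X Y : V) : ℝ := (herm a b h p X Y).re

/-- The fundamental form `Ω` of `g^h`. -/
def kahlerForm (a b : ℂ) (h : ℝ → ℝ) (p X Y : V) : ℝ := -(herm a b h p X Y).im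

/-- The derivative at `p`, along the field `e_i`, of the function `Ω(e_j, e_k)`. -/
def derivKahler (a b : ℂ) (h : ℝ → ℝ) (p : V) (i j k : Fin 4) : ℝ :=
  fderiv ℝ (fun q => kahlerForm a b h q (frame j q) (frame k q)) p (frame i p)

/-- The value `Ω([e_i, e_j], e_k)` at `p`. -/
def bracketKahler (a b : ℂ) (h : ℝ → ℝ) (p : V) (i j k : Fin 4) : ℝ :=
  kahlerForm a b h p (VectorField.lieBracket ℝ (frame i) (frame j) p) (frame k p)

/-- The value `dΩ(e_i, e_j, e_k)` at `p` of the exterior derivative of the fundamental form. -/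
def dKahler (a b : ℂ) (h : ℝ → ℝ) (p : V) (i j k : Fin 4) : ℝ :=
  derivKahler a b h p i j k - derivKahler a b h p j i k + derivKahler a b h p k i j
    - bracketKahler a b h p i j k + bracketKahler a b h p i k j - bracketKahler a b h p j k i

/-- `lee` is the value at `p` of the Lee form: `dΩ = lee ∧ Ω` at `p`. On the tangent space of
`ℝ × S³` at `p` this determines `lee`, since the dimension is four and `Ω` is nondegenerate. -/
def IsLeeFormAt (a b : ℂ) (h : ℝ → ℝ) (p : V) (lee : V →ₗ[ℝ] ℝ) : Prop :=
  ∀ i j k : Fin 4, dKahler a b h p i j k =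
    lee (frame i p) * kahlerForm a b h p (frame j p) (frame k p)
      - lee (frame j p) * kahlerForm a b h p (frame i p) (frame k p)
      + lee (frame k p) * kahlerForm a b h p (frame i p) (frame j p)

/-- The Lee form of `g^h`. -/
def leeForm (a b : ℂ) (h : ℝ → ℝ) (p : V) : V →ₗ[ℝ] ℝ :=
  Classical.epsilon (IsLeeFormAt a b h p)

/-- The distribution `ℱ`: the kernel of the Lee form. -/
def leeKernel (a b : ℂ) (h : ℝ → ℝ) (p : V) : Set V :=
  {X | X ∈ tangent p ∧ leeForm a b h p X = 0}

/-- The distribution `ℱ^⊥`: the orthogonal complement of `ℱ` in the tangent space. -/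
def leePerp (a b : ℂ) (h : ℝ → ℝ) (p : V) : Set V :=
  {X | X ∈ tangent p ∧ ∀ Y ∈ leeKernel a b h p, metric a b h p X Y = 0}

/-- The distribution `Jℱ^⊥`. -/
def jLeePerp (a b : ℂ) (h : ℝ → ℝ) (p : V) : Set V :=
  {Y | Y ∈ tangent p ∧ ∃ X ∈ leePerp a b h p, dF a b p Y = Complex.I • dF a b p X}

/-- The distribution `ℱ^⊥ ⊕ Jℱ^⊥`, tangent to the foliation `ℰ`. -/
def leePlane (a b : ℂ) (h : ℝ → ℝ) (p : V) : Submodule ℝ V :=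
  Submodule.span ℝ (leePerp a b h p ∪ jLeePerp a b h p)

/-- The leaf of `ℰ` through `P`: the points of `S¹ × S³` that are joined to `P` by a `C¹` curve
tangent to the distribution `ℱ^⊥ ⊕ Jℱ^⊥`. The curve is given by its lift `c` to `ℝ × S³`. -/
def leaf (a b : ℂ) (h : ℝ → ℝ) (P : S1 × S3) : Set (S1 × S3) :=
  {Q | ∃ c : ℝ → V, ContDiff ℝ 1 c ∧ (∀ t, OnCover (c t)) ∧
    (∀ t, deriv c t ∈ leePlane a b h (c t)) ∧
    (((c 0).1 : S1) = P.1 ∧ (c 0).2 = P.2.1) ∧ (((c 1).1 : S1) = Q.1 ∧ (c 1).2 = Q.2.1)}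

/-- A set is saturated if it is a union of leaves. -/
def IsSaturated (a b : ℂ) (h : ℝ → ℝ) (C : Set (S1 × S3)) : Prop :=
  ∀ P ∈ C, leaf a b h P ⊆ C

/-- The saturated components of `ℰ`: the minimal nonempty closed saturated sets. -/
def IsSaturatedComponent (a b : ℂ) (h : ℝ → ℝ) (C : Set (S1 × S3)) : Prop :=
  Minimal (fun A : Set (S1 × S3) => A.Nonempty ∧ IsClosed A ∧ IsSaturated a b h A) C

/-- The torus `T(Ξ₁, Ξ₂)` in `S³`: the product of the circles of radii `‖Ξ₁‖` and `‖Ξ₂‖`. -/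
def torus (Ξ : S3) : Set S3 := {ξ | ‖ξ.1.1‖ = ‖Ξ.1.1‖ ∧ ‖ξ.1.2‖ = ‖Ξ.1.2‖}

/-- The sets `S¹ × {ξ₂ = 0}`, `S¹ × {ξ₁ = 0}`, and `S¹ × T(Ξ₁, Ξ₂)` with `Ξ₁ Ξ₂ ≠ 0`. -/
def circlesAndTori : Set (Set (S1 × S3)) :=
  {(Set.univ : Set S1) ×ˢ {ξ : S3 | ξ.1.2 = 0}, (Set.univ : Set S1) ×ˢ {ξ : S3 | ξ.1.1 = 0}} ∪
    {C | ∃ Ξ : S3, Ξ.1.1 * Ξ.1.2 ≠ 0 ∧ C = (Set.univ : Set S1) ×ˢ torus Ξ}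

/-- The rationality conditions `(k arg α - l arg β) / π = p / q` and
`log ‖α‖ / log ‖β‖ = l / k`, for integers with `(p, q) = (l, k) = 1`. -/
def IsRational (a b : ℂ) : Prop :=
  ∃ k l p q : ℤ, k ≠ 0 ∧ q ≠ 0 ∧ IsCoprime p q ∧ IsCoprime l k ∧
    ((k : ℝ) * a.im - (l : ℝ) * b.im) / Real.pi = (p : ℝ) / (q : ℝ) ∧
    a.re / b.re = (l : ℝ) / (k : ℝ)

end

end HopfFoliation

namespace HopfFoliation

/-! The Lee form is `-h dθ`, so `ℱ` is tangent to the spheres `θ = const`, and `ℱ^⊥ ⊕ Jℱ^⊥` is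
Hermitian-orthogonal to the complex line of `frame 2`. This plane is independent of `h`: at each
point it contains `(1, -(Im a/2π) iξ₁, -(Im b/2π) iξ₂)` and its `J`-image up to scale `(0, Re a ·
iξ₁, Re b · iξ₂)`, and every vector in it only rotates `ξ₁` and `ξ₂`.

Hence `‖ξ₁‖` and `‖ξ₂‖` are constant along leaves (`leaf_subset`), and in the coordinates `(θ, arg
ξ₁, arg ξ₂)` on a torus the foliation is by parallel planes (`mem_leaf`). Fix `θ` and `ξ₁`: the
angles of `ξ₂` reached by one leaf form a coset of the subgroup of `ℝ` generated by `2π`, `2π Re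
b/Re a` and `(Re b Im a - Re a Im b)/Re a`. A subgroup of `ℝ` is dense or cyclic, and cyclicity here
gives `α^M = β^N` with `N ≠ 0`, which is (R) by `isRational_iff`. So without (R) every leaf is dense
in its torus (`dense_angles`, `closure_leaf`). These closures partition the space, so they are the
minimal closed saturated sets.

The Lee form is found by computing `dΩ` on the frame (`isLeeFormAt_neg_smul_fst`); nondegeneracy of
`Ω` makes it unique on tangent vectors (`IsLeeFormAt.eq_on_frame`). -/

lemma fderiv_apply_of_curve {E : Type*} [NormedAddCommGroup E] [NormedSpace ℝ E] {f : V → E}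
    {c : ℝ → V} {v : V} {w : E} (hf : DifferentiableAt ℝ f (c 0)) (hc : HasDerivAt c v 0)
    (hd : HasDerivAt (fun t => f (c t)) w 0) : fderiv ℝ f (c 0) v = w :=
  (hf.hasFDerivAt.comp_hasDerivAt 0 hc).unique hd

/-! ### Complex coordinates and the Hermitian form -/

lemma dF_apply (a b : ℂ) (p X : V) :
    dF a b p X =
      (Complex.exp ((p.1 : ℂ) * a / (2 * Real.pi)) * ((X.1 : ℂ) * a / (2 * Real.pi) * p.2.1 + X.2.1),
        Complex.exp ((p.1 : ℂ) * b / (2 * Real.pi)) *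
          ((X.1 : ℂ) * b / (2 * Real.pi) * p.2.2 + X.2.2)) := by
  have h1 : HasFDerivAt (fun q : V => q.1) (ContinuousLinearMap.fst ℝ ℝ (ℂ × ℂ)) p :=
    hasFDerivAt_fst
  have hs : HasFDerivAt (fun q : V => q.2) (ContinuousLinearMap.snd ℝ ℝ (ℂ × ℂ)) p :=
    hasFDerivAt_snd
  have h1c : HasFDerivAt (fun q : V => (q.1 : ℂ))
      (Complex.ofRealCLM.comp (ContinuousLinearMap.fst ℝ ℝ (ℂ × ℂ))) p :=
    Complex.ofRealCLM.hasFDerivAt.comp p h1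
  have key (a : ℂ) : HasFDerivAt
      (fun q : V => Complex.exp ((q.1 : ℂ) * a / (2 * Real.pi))) _ p :=
    ((h1c.mul_const a).mul_const ((2 * Real.pi : ℂ)⁻¹)).cexp
  have hF := ((key a).mul hs.fst).prodMk ((key b).mul hs.snd)
  have : dF a b p = _ := hF.fderiv
  rw [this]
  refine Prod.ext ?_ ?_ <;> simp <;> ring_nf

/-- Cramer's rule; the exponential factors cancel. The formula is kept valid off the sphere because
`derivKahler` differentiates in the ambient space `V`, so differentiability is needed on a
neighbourhood there. -/
lemma coords_eq (a b : ℂ) {p : V} (X : V)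
    (hN : p.2.1 * (starRingEnd ℂ) p.2.1 + p.2.2 * (starRingEnd ℂ) p.2.2 ≠ 0) :
    coords a b p X =
      ![((starRingEnd ℂ) p.2.1 * ((X.1 : ℂ) * a / (2 * Real.pi) * p.2.1 + X.2.1) +
          (starRingEnd ℂ) p.2.2 * ((X.1 : ℂ) * b / (2 * Real.pi) * p.2.2 + X.2.2)) /
          (Complex.I * (p.2.1 * (starRingEnd ℂ) p.2.1 + p.2.2 * (starRingEnd ℂ) p.2.2)),
        (p.2.1 * ((X.1 : ℂ) * b / (2 * Real.pi) * p.2.2 + X.2.2) -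
          p.2.2 * ((X.1 : ℂ) * a / (2 * Real.pi) * p.2.1 + X.2.1)) /
          (p.2.1 * (starRingEnd ℂ) p.2.1 + p.2.2 * (starRingEnd ℂ) p.2.2)] := by
  have e1 := Complex.exp_ne_zero ((p.1 : ℂ) * a / (2 * Real.pi))
  have e2 := Complex.exp_ne_zero ((p.1 : ℂ) * b / (2 * Real.pi))
  simp only [coords, dF_apply]
  generalize (X.1 : ℂ) * b / (2 * Real.pi) * p.2.2 + X.2.2 = y2
  generalize (X.1 : ℂ) * a / (2 * Real.pi) * p.2.1 + X.2.1 = y1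
  generalize Complex.exp ((p.1 : ℂ) * a / (2 * Real.pi)) = E1 at *
  generalize Complex.exp ((p.1 : ℂ) * b / (2 * Real.pi)) = E2 at *
  have hI := Complex.I_ne_zero
  rw [Matrix.inv_def, Matrix.adjugate_fin_two_of, Matrix.det_fin_two_of]
  simp only [frame, Ring.inverse_eq_inv']
  have hd : E1 * (Complex.I * p.2.1) * (E2 * (starRingEnd ℂ) p.2.1) +
      E1 * (starRingEnd ℂ) p.2.2 * (E2 * (Complex.I * p.2.2)) =
      E1 * E2 * Complex.I * (p.2.1 * (starRingEnd ℂ) p.2.1 + p.2.2 * (starRingEnd ℂ) p.2.2) := by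
    ring
  ext i
  fin_cases i <;> simp [Matrix.mulVec, dotProduct, Fin.sum_univ_two] <;> rw [hd] <;> field_simp <;>
    ring

lemma OnCover.mul_conj_add {p : V} (hp : OnCover p) :
    p.2.1 * (starRingEnd ℂ) p.2.1 + p.2.2 * (starRingEnd ℂ) p.2.2 = 1 := by
  rw [Complex.mul_conj', Complex.mul_conj']
  exact_mod_cast hp

lemma coords_eq_of_onCover (a b : ℂ) {p : V} (hp : OnCover p) (X : V) :
    coords a b p X =
      ![-Complex.I * ((starRingEnd ℂ) p.2.1 * ((X.1 : ℂ) * a / (2 * Real.pi) * p.2.1 + X.2.1) +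
          (starRingEnd ℂ) p.2.2 * ((X.1 : ℂ) * b / (2 * Real.pi) * p.2.2 + X.2.2)),
        p.2.1 * ((X.1 : ℂ) * b / (2 * Real.pi) * p.2.2 + X.2.2) -
          p.2.2 * ((X.1 : ℂ) * a / (2 * Real.pi) * p.2.1 + X.2.1)] := by
  rw [coords_eq a b X (by rw [hp.mul_conj_add]; exact one_ne_zero), hp.mul_conj_add]
  simp only [mul_one, div_one, Complex.div_I]
  congr 1
  ring

lemma coords_frame_one (a b : ℂ) {p : V} (hp : OnCover p) :
    coords a b p (frame 1 p) = ![1, 0] := by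
  rw [coords_eq_of_onCover a b hp]
  have := hp.mul_conj_add
  congr 1
  · simp [frame]
    linear_combination this - (p.2.1 * (starRingEnd ℂ) p.2.1 + p.2.2 * (starRingEnd ℂ) p.2.2) * Complex.I_sq
  · simp [frame]; ring

lemma coords_frame_two (a b : ℂ) {p : V} (hp : OnCover p) :
    coords a b p (frame 2 p) = ![0, 1] := by
  rw [coords_eq_of_onCover a b hp]
  have := hp.mul_conj_add
  congr 1
  · simp [frame]; ring
  · simp [frame]; linear_combination this

lemma coords_frame_three (a b : ℂ) {p : V} (hp : OnCover p) :
    coords a b p (frame 3 p) = ![0, Complex.I] := by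
  rw [coords_eq_of_onCover a b hp]
  have := hp.mul_conj_add
  congr 1
  · simp [frame]; ring
  · simp [frame]; linear_combination Complex.I * this

lemma coords_frame_zero (a b : ℂ) {p : V} (hp : OnCover p) :
    coords a b p (frame 0 p) =
      ![-Complex.I * (p.2.1 * (starRingEnd ℂ) p.2.1 * a + p.2.2 * (starRingEnd ℂ) p.2.2 * b) /
          (2 * Real.pi),
        (b - a) * (p.2.1 * p.2.2) / (2 * Real.pi)] := by
  rw [coords_eq_of_onCover a b hp]
  congr 1
  · simp [frame]; ring
  · simp [frame]; ring

lemma herm_eq (a b : ℂ) (h : ℝ → ℝ) (p X Y : V) :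
    herm a b h p X Y =
      (coords a b p X 0 * metricMatrix a b h p 0 0 + coords a b p X 1 * metricMatrix a b h p 1 0) *
          (starRingEnd ℂ) (coords a b p Y 0) +
        (coords a b p X 0 * metricMatrix a b h p 0 1 +
          coords a b p X 1 * metricMatrix a b h p 1 1) * (starRingEnd ℂ) (coords a b p Y 1) := by
  simp only [herm, Fin.sum_univ_two]; ring

lemma herm_conj (a b : ℂ) (h : ℝ → ℝ) (p X Y : V) :
    (starRingEnd ℂ) (herm a b h p X Y) = herm a b h p Y X := by
  rw [herm_eq, herm_eq]
  simp [metricMatrix]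
  ring

lemma kahlerForm_antisymm (a b : ℂ) (h : ℝ → ℝ) (p X Y : V) :
    kahlerForm a b h p X Y = -kahlerForm a b h p Y X := by
  rw [kahlerForm, kahlerForm, ← herm_conj a b h p X Y, Complex.conj_im]; ring

lemma kahlerForm_self (a b : ℂ) (h : ℝ → ℝ) (p X : V) : kahlerForm a b h p X X = 0 := by
  have := kahlerForm_antisymm a b h p X X
  linarith

lemma coords_smul (a b : ℂ) (p X : V) (r : ℝ) :
    coords a b p (r • X) = (r : ℂ) • coords a b p X := by
  simp only [coords, map_smul, ← Matrix.mulVec_smul]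
  congr 1
  ext i; fin_cases i <;> simp

lemma coords_add (a b : ℂ) (p X Y : V) :
    coords a b p (X + Y) = coords a b p X + coords a b p Y := by
  simp only [coords, map_add, ← Matrix.mulVec_add]
  congr 1
  ext i; fin_cases i <;> simp

lemma herm_smul_left (a b : ℂ) (h : ℝ → ℝ) (p X Y : V) (r : ℝ) :
    herm a b h p (r • X) Y = r * herm a b h p X Y := by
  simp only [herm_eq, coords_smul, Pi.smul_apply, smul_eq_mul]; ring

lemma herm_add_left (a b : ℂ) (h : ℝ → ℝ) (p X X' Y : V) :
    herm a b h p (X + X') Y = herm a b h p X Y + herm a b h p X' Y := by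
  simp only [herm_eq, coords_add, Pi.add_apply]; ring

lemma kahlerForm_smul_left (a b : ℂ) (h : ℝ → ℝ) (p X Y : V) (r : ℝ) :
    kahlerForm a b h p (r • X) Y = r * kahlerForm a b h p X Y := by
  simp [kahlerForm, herm_smul_left]

lemma kahlerForm_neg_left (a b : ℂ) (h : ℝ → ℝ) (p X Y : V) :
    kahlerForm a b h p (-X) Y = -kahlerForm a b h p X Y := by
  simpa using kahlerForm_smul_left a b h p X Y (-1)

lemma herm_frame_two (a b : ℂ) (h : ℝ → ℝ) {p : V} (hp : OnCover p) (X : V) :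
    herm a b h p X (frame 2 p) = coords a b p X 0 * metricMatrix a b h p 0 1 +
      coords a b p X 1 * metricMatrix a b h p 1 1 := by
  rw [herm_eq, coords_frame_two a b hp]; simp

lemma herm_frame_one (a b : ℂ) (h : ℝ → ℝ) {p : V} (hp : OnCover p) (X : V) :
    herm a b h p X (frame 1 p) = coords a b p X 0 * metricMatrix a b h p 0 0 +
      coords a b p X 1 * metricMatrix a b h p 1 0 := by
  rw [herm_eq, coords_frame_one a b hp]; simp

/-- `frame 3` is `J` applied to `frame 2`, and the form is antilinear in its second argument. -/
lemma herm_frame_three (a b : ℂ) (h : ℝ → ℝ) {p : V} (hp : OnCover p) (X : V) :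
    herm a b h p X (frame 3 p) = -Complex.I * herm a b h p X (frame 2 p) := by
  rw [herm_frame_two a b h hp, herm_eq, coords_frame_three a b hp]; simp; ring

lemma reG_pos {a b : ℂ} (ha : 0 < a.re) (hb : 0 < b.re) {p : V} (hp : OnCover p) :
    0 < reG a b p := by
  have h1 : reG a b p ≥ min a.re b.re * (‖p.2.1‖ ^ 2 + ‖p.2.2‖ ^ 2) := by
    unfold reG
    nlinarith [mul_le_mul_of_nonneg_left (min_le_left a.re b.re) (sq_nonneg ‖p.2.1‖),
      mul_le_mul_of_nonneg_left (min_le_right a.re b.re) (sq_nonneg ‖p.2.2‖)]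
  rw [hp] at h1
  have := lt_min ha hb
  linarith

/-! ### The fundamental form on the frame, and the Lie brackets -/

section

lemma coords_frame_zero_zero (a b : ℂ) {p : V} (hp : OnCover p) :
    coords a b p (frame 0 p) 0 =
      (((‖p.2.1‖ ^ 2 * a.im + ‖p.2.2‖ ^ 2 * b.im) / (2 * Real.pi) : ℝ) : ℂ) -
        ((reG a b p / (2 * Real.pi) : ℝ) : ℂ) * Complex.I := by
  rw [coords_frame_zero a b hp, Complex.mul_conj', Complex.mul_conj']
  apply Complex.ext
  · simp [reG, ← Complex.ofReal_pow, ← Complex.ofReal_ofNat, ← Complex.ofReal_mul,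
      Complex.div_ofReal_re]
  · simp [reG, ← Complex.ofReal_pow, ← Complex.ofReal_ofNat, ← Complex.ofReal_mul,
      Complex.div_ofReal_im]
    ring

lemma coords_frame_zero_one (a b : ℂ) {p : V} (hp : OnCover p) :
    coords a b p (frame 0 p) 1 =
      -((((a.re - b.re) / (2 * Real.pi) : ℝ) : ℂ) +
        (((a.im - b.im) / (2 * Real.pi) : ℝ) : ℂ) * Complex.I) * (p.2.1 * p.2.2) := by
  rw [coords_frame_zero a b hp]
  simp only [Matrix.cons_val_one, Matrix.cons_val_fin_one]
  conv_lhs => rw [← Complex.re_add_im a, ← Complex.re_add_im b]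
  push_cast
  ring

variable {a b : ℂ} (h : ℝ → ℝ) {p : V}

/-- The `L²` term of the diagonal entry of the metric cancels against the off-diagonal contribution,
leaving only the term in `h`. -/
lemma kahlerForm_zero_one (ha : 0 < a.re) (hb : 0 < b.re) (hp : OnCover p) :
    kahlerForm a b h p (frame 0 p) (frame 1 p) = h p.1 / (2 * reG a b p) := by
  have hR := (reG_pos ha hb hp).ne'
  have hpi := Real.pi_ne_zero
  rw [kahlerForm, herm_frame_one a b h hp, coords_frame_zero_zero a b hp,
    coords_frame_zero_one a b hp]
  have hP : p.2.1 * p.2.2 * (starRingEnd ℂ) (Complex.I * p.2.1 * p.2.2) =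
      -Complex.I * ((‖p.2.1‖ ^ 2 * ‖p.2.2‖ ^ 2 : ℝ) : ℂ) := by
    push_cast
    rw [← Complex.mul_conj', ← Complex.mul_conj']
    simp
    ring
  simp only [metricMatrix, Matrix.of_apply, Matrix.cons_val', Matrix.cons_val_zero,
    Matrix.cons_val_fin_one, Matrix.cons_val_one]
  generalize (‖p.2.1‖ ^ 2 * a.im + ‖p.2.2‖ ^ 2 * b.im) / (2 * Real.pi) = c
  generalize (a.im - b.im) / (2 * Real.pi) = l'
  generalize hm : Real.pi * h p.1 / reG a b p ^ 2 +
    ‖p.2.1‖ ^ 2 * ‖p.2.2‖ ^ 2 * (a.re - b.re) ^ 2 / reG a b p ^ 3 = m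
  have key (r l n L s : ℝ) (Q Q' : ℂ) (hQ : Q * Q' = -Complex.I * (n : ℂ)) :
      ((c : ℂ) - (r : ℂ) * Complex.I) * (m : ℂ) +
        -((l : ℂ) + (l' : ℂ) * Complex.I) * Q * (Q' * (L : ℂ) / (s : ℂ)) =
      ((c * m - l' * n * L / s : ℝ) : ℂ) + ((l * n * L / s - r * m : ℝ) : ℂ) * Complex.I := by
    push_cast
    linear_combination (-((l : ℂ) + (l' : ℂ) * Complex.I) * L / s) * hQ +
      (l' * n * L / s : ℂ) * Complex.I_sq
  rw [key _ _ _ _ _ _ _ hP, Complex.add_im, Complex.ofReal_im, Complex.im_ofReal_mul,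
    Complex.I_im, ← hm]
  field_simp
  ring

/-- Makes the numerator in `herm_zero_two` a constant, so that only `ξ₁ξ₂ / R²` has to be
differentiated later. -/
lemma reG_identity (hp : OnCover p) :
    (a.im - b.im) * reG a b p - (a.re - b.re) * (‖p.2.1‖ ^ 2 * a.im + ‖p.2.2‖ ^ 2 * b.im) =
      a.im * b.re - a.re * b.im := by
  have : ‖p.2.1‖ ^ 2 + ‖p.2.2‖ ^ 2 = 1 := hp
  unfold reG
  linear_combination (a.im * b.re - a.re * b.im) * this

lemma herm_zero_two (ha : 0 < a.re) (hb : 0 < b.re) (hp : OnCover p) :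
    herm a b h p (frame 0 p) (frame 2 p) =
      -Complex.I * (p.2.1 * p.2.2) *
        (((a.im * b.re - a.re * b.im) / (2 * Real.pi * reG a b p ^ 2) : ℝ) : ℂ) := by
  have hR : ((reG a b p : ℝ) : ℂ) ≠ 0 := by exact_mod_cast (reG_pos ha hb hp).ne'
  have hpi : (Real.pi : ℂ) ≠ 0 := by exact_mod_cast Real.pi_ne_zero
  rw [herm_frame_two a b h hp, coords_frame_zero_zero a b hp,
    coords_frame_zero_one a b hp, ← reG_identity hp]
  simp only [metricMatrix]
  simp
  generalize (reG a b p : ℂ) = R at *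
  field_simp
  ring_nf
  simp only [Complex.I_sq]
  ring

lemma kahlerForm_zero_two (ha : 0 < a.re) (hb : 0 < b.re) (hp : OnCover p) :
    kahlerForm a b h p (frame 0 p) (frame 2 p) =
      (a.im * b.re - a.re * b.im) / (2 * Real.pi) * ((p.2.1 * p.2.2).re / reG a b p ^ 2) := by
  rw [kahlerForm, herm_zero_two h ha hb hp, Complex.im_mul_ofReal]
  simp only [neg_mul, Complex.neg_im, Complex.I_mul_im]
  ring

lemma kahlerForm_zero_three (ha : 0 < a.re) (hb : 0 < b.re) (hp : OnCover p) :
    kahlerForm a b h p (frame 0 p) (frame 3 p) =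
      (a.im * b.re - a.re * b.im) / (2 * Real.pi) * ((p.2.1 * p.2.2).im / reG a b p ^ 2) := by
  rw [kahlerForm, herm_frame_three a b h hp, herm_zero_two h ha hb hp, ← mul_assoc,
    Complex.im_mul_ofReal]
  simp only [neg_mul, Complex.neg_im, Complex.I_mul_im, mul_neg, Complex.I_mul_re]
  ring

lemma herm_one_two (hp : OnCover p) :
    herm a b h p (frame 1 p) (frame 2 p) =
      Complex.I * (p.2.1 * p.2.2) * (((a.re - b.re) / reG a b p ^ 2 : ℝ) : ℂ) := by
  rw [herm_frame_two a b h hp, coords_frame_one a b hp]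
  simp [metricMatrix]
  ring

lemma kahlerForm_one_two (hp : OnCover p) :
    kahlerForm a b h p (frame 1 p) (frame 2 p) =
      -(a.re - b.re) * ((p.2.1 * p.2.2).re / reG a b p ^ 2) := by
  rw [kahlerForm, herm_one_two h hp, Complex.im_mul_ofReal, Complex.I_mul_im]
  ring

lemma kahlerForm_one_three (hp : OnCover p) :
    kahlerForm a b h p (frame 1 p) (frame 3 p) =
      -(a.re - b.re) * ((p.2.1 * p.2.2).im / reG a b p ^ 2) := by
  rw [kahlerForm, herm_frame_three a b h hp, herm_one_two h hp, ← mul_assoc,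
    Complex.im_mul_ofReal]
  simp only [neg_mul, Complex.neg_im, Complex.I_mul_im, Complex.I_mul_re]
  ring

lemma kahlerForm_two_three (hp : OnCover p) :
    kahlerForm a b h p (frame 2 p) (frame 3 p) = 1 / reG a b p := by
  rw [kahlerForm, herm_frame_three a b h hp, herm_frame_two a b h hp, coords_frame_two a b hp]
  simp [metricMatrix]

/-! The frame fields along the sphere are restrictions of linear maps. -/

/-- The linear map extending the frame field of index `k ≠ 0`. -/
noncomputable def frameMap (k : Fin 4) (hk : k ≠ 0) : V →L[ℝ] V :=
  LinearMap.toContinuousLinearMap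
    { toFun := frame k
      map_add' := fun x y => by
        fin_cases k
        · exact absurd rfl hk
        all_goals (simp [frame] <;> first | (constructor <;> ring) | ring)
      map_smul' := fun r x => by
        fin_cases k
        · exact absurd rfl hk
        all_goals simp [frame] <;> ring_nf <;> trivial }

lemma frameMap_apply {k : Fin 4} (hk : k ≠ 0) (v : V) : frameMap k hk v = frame k v := rfl

lemma hasFDerivAt_frame {k : Fin 4} (hk : k ≠ 0) (p : V) :
    HasFDerivAt (frame k) (frameMap k hk) p := (frameMap k hk).hasFDerivAt

lemma differentiable_frame (k : Fin 4) : Differentiable ℝ (frame k) := by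
  by_cases hk : k = 0
  · subst hk; exact differentiable_const _
  · exact fun p => (hasFDerivAt_frame hk p).differentiableAt

lemma fderiv_frame {k : Fin 4} (hk : k ≠ 0) (p v : V) :
    fderiv ℝ (frame k) p v = frame k v := by
  rw [(hasFDerivAt_frame hk p).fderiv, frameMap_apply]

lemma fderiv_frame_zero (p v : V) : fderiv ℝ (frame 0) p v = 0 := by
  have : frame 0 = fun _ => ((1 : ℝ), (0 : ℂ), (0 : ℂ)) := rfl
  rw [this, fderiv_fun_const]; rfl

lemma lieBracket_frame_zero (k : Fin 4) (p : V) :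
    VectorField.lieBracket ℝ (frame 0) (frame k) p = 0 := by
  rw [VectorField.lieBracket, fderiv_frame_zero]
  by_cases hk : k = 0
  · subst hk; rw [fderiv_frame_zero]; simp
  · rw [fderiv_frame hk]
    fin_cases k
    · exact absurd rfl hk
    all_goals simp [frame]

lemma lieBracket_frame_one_two (p : V) :
    VectorField.lieBracket ℝ (frame 1) (frame 2) p = (-2 : ℝ) • frame 3 p := by
  rw [VectorField.lieBracket, fderiv_frame (by decide), fderiv_frame (by decide)]
  simp [frame]
  constructor <;> ring

lemma lieBracket_frame_one_three (p : V) :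
    VectorField.lieBracket ℝ (frame 1) (frame 3) p = (2 : ℝ) • frame 2 p := by
  rw [VectorField.lieBracket, fderiv_frame (by decide), fderiv_frame (by decide)]
  simp [frame]
  constructor <;> ring_nf <;> simp only [Complex.I_sq] <;> ring

lemma lieBracket_frame_two_three (p : V) :
    VectorField.lieBracket ℝ (frame 2) (frame 3) p = (-2 : ℝ) • frame 1 p := by
  rw [VectorField.lieBracket, fderiv_frame (by decide), fderiv_frame (by decide)]
  simp [frame]
  constructor <;> ring

end

/-! ### Derivatives of the fundamental form along the frame -/

section

variable {a b : ℂ} {h : ℝ → ℝ} {p : V}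

lemma differentiableAt_coords (hp : OnCover p) (j : Fin 4) (i : Fin 2) :
    DifferentiableAt ℝ (fun q => coords a b q (frame j q) i) p := by
  have hf := differentiable_frame j p
  have h0 : DifferentiableAt ℝ (fun q : V => (((frame j q).1 : ℝ) : ℂ)) p :=
    Complex.ofRealCLM.differentiableAt.comp p hf.fst
  have hid : DifferentiableAt ℝ (fun q : V => q) p := differentiableAt_id
  have h1 : DifferentiableAt ℝ (fun q : V => q.2.1) p := hid.snd.fst
  have h2 : DifferentiableAt ℝ (fun q : V => q.2.2) p := hid.snd.snd
  have c1 : DifferentiableAt ℝ (fun q : V => (starRingEnd ℂ) q.2.1) p := h1.star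
  have c2 : DifferentiableAt ℝ (fun q : V => (starRingEnd ℂ) q.2.2) p := h2.star
  have f1 : DifferentiableAt ℝ (fun q : V => (frame j q).2.1) p := hf.snd.fst
  have f2 : DifferentiableAt ℝ (fun q : V => (frame j q).2.2) p := hf.snd.snd
  have hN : DifferentiableAt ℝ (fun q : V =>
      q.2.1 * (starRingEnd ℂ) q.2.1 + q.2.2 * (starRingEnd ℂ) q.2.2) p :=
    (h1.mul c1).add (h2.mul c2)
  have hN0 : p.2.1 * (starRingEnd ℂ) p.2.1 + p.2.2 * (starRingEnd ℂ) p.2.2 ≠ 0 := by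
    rw [hp.mul_conj_add]; exact one_ne_zero
  have hev := hN.continuousAt.eventually_ne hN0
  have y1 := (((h0.mul_const a).mul_const ((2 * Real.pi : ℂ)⁻¹)).mul h1).add f1
  have y2 := (((h0.mul_const b).mul_const ((2 * Real.pi : ℂ)⁻¹)).mul h2).add f2
  have hIN : DifferentiableAt ℝ (fun q : V => Complex.I *
      (q.2.1 * (starRingEnd ℂ) q.2.1 + q.2.2 * (starRingEnd ℂ) q.2.2)) p := hN.const_mul _
  fin_cases i
  · refine DifferentiableAt.congr_of_eventuallyEq
      (((c1.mul y1).add (c2.mul y2)).mul (hIN.inv (mul_ne_zero Complex.I_ne_zero hN0))) ?_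
    filter_upwards [hev] with q hq
    rw [coords_eq a b _ hq]
    simp [div_eq_mul_inv]
  · refine DifferentiableAt.congr_of_eventuallyEq
      (((h1.mul y2).sub (h2.mul y1)).mul (hN.inv hN0)) ?_
    filter_upwards [hev] with q hq
    rw [coords_eq a b _ hq]
    simp [div_eq_mul_inv]

lemma differentiableAt_metricMatrix (ha : 0 < a.re) (hb : 0 < b.re) (hp : OnCover p)
    (hh : DifferentiableAt ℝ h p.1) (i j : Fin 2) :
    DifferentiableAt ℝ (fun q => metricMatrix a b h q i j) p := by
  have hid : DifferentiableAt ℝ (fun q : V => q) p := differentiableAt_id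
  have h1 : DifferentiableAt ℝ (fun q : V => q.2.1) p := hid.snd.fst
  have h2 : DifferentiableAt ℝ (fun q : V => q.2.2) p := hid.snd.snd
  have n1 : DifferentiableAt ℝ (fun q : V => ‖q.2.1‖ ^ 2) p := h1.norm_sq ℝ
  have n2 : DifferentiableAt ℝ (fun q : V => ‖q.2.2‖ ^ 2) p := h2.norm_sq ℝ
  have hR : DifferentiableAt ℝ (fun q : V => reG a b q) p :=
    (n1.mul_const a.re).add (n2.mul_const b.re)
  have hR0 := (reG_pos ha hb hp).ne'
  have cast {f : V → ℝ} (hf : DifferentiableAt ℝ f p) :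
      DifferentiableAt ℝ (fun q => (f q : ℂ)) p := Complex.ofRealCLM.differentiableAt.comp p hf
  have hh' : DifferentiableAt ℝ (fun q : V => h q.1) p := hh.comp p hid.fst
  have hRc : DifferentiableAt ℝ (fun q : V => ((reG a b q ^ 2 : ℝ) : ℂ)⁻¹) p :=
    (cast (hR.pow 2)).inv (by exact_mod_cast pow_ne_zero 2 hR0)
  have hP := (h1.const_mul Complex.I).mul h2
  have hPc : DifferentiableAt ℝ (fun q : V => (starRingEnd ℂ) (Complex.I * q.2.1 * q.2.2)) p :=
    hP.star
  fin_cases i <;> fin_cases j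
  · exact cast (((hh'.const_mul _).mul ((hR.pow 2).inv (pow_ne_zero 2 hR0))).add
      (((n1.mul n2).mul_const _).mul ((hR.pow 3).inv (pow_ne_zero 3 hR0))))
  · exact (hP.mul_const _).mul hRc
  · exact (hPc.mul_const _).mul hRc
  · exact cast ((hR.inv hR0).const_mul 1)

lemma differentiableAt_kahlerForm (ha : 0 < a.re) (hb : 0 < b.re) (hp : OnCover p)
    (hh : DifferentiableAt ℝ h p.1) (j k : Fin 4) :
    DifferentiableAt ℝ (fun q => kahlerForm a b h q (frame j q) (frame k q)) p := by
  have hc (i : Fin 2) : DifferentiableAt ℝ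
      (fun q => (starRingEnd ℂ) (coords a b q (frame k q) i)) p :=
    (differentiableAt_coords hp k i).star
  have hherm : DifferentiableAt ℝ (fun q => herm a b h q (frame j q) (frame k q)) p := by
    unfold herm
    exact DifferentiableAt.fun_sum fun i _ => DifferentiableAt.fun_sum fun l _ =>
      ((differentiableAt_coords hp j i).mul
        (differentiableAt_metricMatrix ha hb hp hh i l)).mul (hc l)
  exact (Complex.imCLM.differentiableAt.comp p hherm).neg

/-- Through every point of the cover there is a curve on the cover with velocity `e_i`. -/
lemma exists_curve (hp : OnCover p) (i : Fin 4) :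
    ∃ c : ℝ → V, c 0 = p ∧ HasDerivAt c (frame i p) 0 ∧ ∀ t, OnCover (c t) := by
  have hp' : ‖p.2.1‖ ^ 2 + ‖p.2.2‖ ^ 2 = 1 := hp
  by_cases hi : i = 0
  · subst hi
    refine ⟨fun t => (p.1 + t, p.2), by simp, ?_, fun t => hp⟩
    exact ((hasDerivAt_id (0 : ℝ)).const_add p.1).prodMk (hasDerivAt_const _ _)
  -- A great circle: the sphere part of `frame i p` is a unit vector orthogonal to `p.2`.
  · refine ⟨fun t => (p.1, Real.cos t • p.2 + Real.sin t • (frame i p).2), by simp, ?_, fun t => ?_⟩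
    · have h2 := ((Real.hasDerivAt_cos 0).smul_const p.2).add
        ((Real.hasDerivAt_sin 0).smul_const (frame i p).2)
      have h0 : (frame i p).1 = 0 := by
        fin_cases i
        · exact absurd rfl hi
        all_goals rfl
      have h3 : frame i p =
          (0, -Real.sin 0 • p.2 + Real.cos 0 • (frame i p).2) := Prod.ext h0 (by simp)
      exact ((hasDerivAt_const (0 : ℝ) p.1).prodMk h2).congr_deriv h3.symm
    · have hcs := Real.sin_sq_add_cos_sq t
      unfold OnCover
      rw [← Complex.normSq_eq_norm_sq, ← Complex.normSq_eq_norm_sq, Complex.normSq_apply,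
        Complex.normSq_apply] at hp' ⊢
      beta_reduce
      generalize Real.sin t = s at *
      generalize Real.cos t = r at *
      fin_cases i
      · exact absurd rfl hi
      all_goals
        simp [frame]
        linear_combination (s ^ 2 + r ^ 2) * hp' + hcs

/-- The derivative of `reG` at `p` along `v`. -/
noncomputable def dReG (a b : ℂ) (p v : V) : ℝ :=
  2 * ((starRingEnd ℂ) p.2.1 * v.2.1).re * a.re + 2 * ((starRingEnd ℂ) p.2.2 * v.2.2).re * b.re

lemma hasDerivAt_coord_zero {c : ℝ → V} {v : V} {t : ℝ} (hc : HasDerivAt c v t) :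
    HasDerivAt (fun t => (c t).1) v.1 t :=
  (ContinuousLinearMap.fst ℝ ℝ (ℂ × ℂ)).hasFDerivAt.comp_hasDerivAt t hc

lemma hasDerivAt_coord_one {c : ℝ → V} {v : V} {t : ℝ} (hc : HasDerivAt c v t) :
    HasDerivAt (fun t => (c t).2.1) v.2.1 t :=
  ((ContinuousLinearMap.fst ℝ ℂ ℂ).comp
    (ContinuousLinearMap.snd ℝ ℝ (ℂ × ℂ))).hasFDerivAt.comp_hasDerivAt t hc

lemma hasDerivAt_coord_two {c : ℝ → V} {v : V} {t : ℝ} (hc : HasDerivAt c v t) :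
    HasDerivAt (fun t => (c t).2.2) v.2.2 t :=
  ((ContinuousLinearMap.snd ℝ ℂ ℂ).comp
    (ContinuousLinearMap.snd ℝ ℝ (ℂ × ℂ))).hasFDerivAt.comp_hasDerivAt t hc

lemma hasDerivAt_reG {c : ℝ → V} {v : V} (hc : HasDerivAt c v 0) :
    HasDerivAt (fun t => reG a b (c t)) (dReG a b (c 0) v) 0 := by
  have n1 := (HasDerivAt.norm_sq (hasDerivAt_coord_one hc)).mul_const a.re
  have n2 := (HasDerivAt.norm_sq (hasDerivAt_coord_two hc)).mul_const b.re
  have hd : dReG a b (c 0) v = 2 * inner ℝ (c 0).2.1 v.2.1 * a.re +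
      2 * inner ℝ (c 0).2.2 v.2.2 * b.re := by
    simp [dReG, Complex.inner]
    ring
  rw [hd]
  exact n1.add n2

lemma hasDerivAt_mul {c : ℝ → V} {v : V} (hc : HasDerivAt c v 0) :
    HasDerivAt (fun t => (c t).2.1 * (c t).2.2) (v.2.1 * (c 0).2.2 + (c 0).2.1 * v.2.2) 0 :=
  (hasDerivAt_coord_one hc).fun_mul (hasDerivAt_coord_two hc)

/-- The closed formulas for `Ω` hold only on `ℝ × S³`, but `e_i` is tangent to it, so the ambient
derivative can be computed along a curve that stays on the cover. -/
lemma derivKahler_eq (ha : 0 < a.re) (hb : 0 < b.re) (hp : OnCover p)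
    (hh : DifferentiableAt ℝ h p.1) {i j k : Fin 4} {g : V → ℝ} {w : ℝ}
    (hg : ∀ q, OnCover q → kahlerForm a b h q (frame j q) (frame k q) = g q)
    (hw : ∀ c : ℝ → V, c 0 = p → HasDerivAt c (frame i p) 0 →
      HasDerivAt (fun t => g (c t)) w 0) :
    derivKahler a b h p i j k = w := by
  obtain ⟨c, hc0, hc, hon⟩ := exists_curve hp i
  have hd := differentiableAt_kahlerForm ha hb hp hh j k
  rw [← hc0] at hd
  have := fderiv_apply_of_curve hd hc (w := w) (by simpa only [hg _ (hon _)] using hw c hc0 hc)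
  rw [← this, hc0, derivKahler]

lemma hasDerivAt_div_sq {x R : ℝ → ℝ} {x' R' : ℝ} (hx : HasDerivAt x x' 0) (hR : HasDerivAt R R' 0)
    (h0 : R 0 ≠ 0) :
    HasDerivAt (fun t => x t / R t ^ 2) (x' / R 0 ^ 2 - 2 * x 0 * R' / R 0 ^ 3) 0 := by
  have hd : x' / R 0 ^ 2 - 2 * x 0 * R' / R 0 ^ 3 =
      (x' * R 0 ^ 2 - x 0 * (((2 : ℕ) : ℝ) * R 0 ^ (2 - 1) * R')) / (R 0 ^ 2) ^ 2 := by
    field_simp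
    norm_num
    ring
  rw [hd]
  exact hx.fun_div (hR.fun_pow 2) (pow_ne_zero 2 h0)

section Deriv

variable (ha : 0 < a.re) (hb : 0 < b.re) (hp : OnCover p) (hh : DifferentiableAt ℝ h p.1)
  (i : Fin 4)
include ha hb hp hh

lemma derivKahler_zero_one :
    derivKahler a b h p i 0 1 = deriv h p.1 * (frame i p).1 / (2 * reG a b p) -
      h p.1 * dReG a b p (frame i p) / (2 * reG a b p ^ 2) := by
  refine derivKahler_eq ha hb hp hh (fun q hq => kahlerForm_zero_one h ha hb hq) fun c hc0 hc => ?_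
  subst hc0
  have hR0 := (reG_pos ha hb hp).ne'
  have hd (x y z R r : ℝ) (hR : R ≠ 0) : x * y / (2 * R) - z * r / (2 * R ^ 2) =
      (x * y * (2 * R) - z * (2 * r)) / (2 * R) ^ 2 := by
    field_simp
  rw [hd _ _ _ _ _ hR0]
  exact (hh.hasDerivAt.comp (0 : ℝ) (hasDerivAt_coord_zero hc)).fun_div
    ((hasDerivAt_reG hc).const_mul 2) (mul_ne_zero two_ne_zero hR0)

lemma derivKahler_re {j k : Fin 4} (C : ℝ)
    (hg : ∀ q, OnCover q → kahlerForm a b h q (frame j q) (frame k q) =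
      C * ((q.2.1 * q.2.2).re / reG a b q ^ 2)) :
    derivKahler a b h p i j k =
      C * (((frame i p).2.1 * p.2.2 + p.2.1 * (frame i p).2.2).re / reG a b p ^ 2 -
        2 * (p.2.1 * p.2.2).re * dReG a b p (frame i p) / reG a b p ^ 3) := by
  refine derivKahler_eq ha hb hp hh hg fun c hc0 hc => ?_
  subst hc0
  exact (hasDerivAt_div_sq (Complex.reCLM.hasFDerivAt.comp_hasDerivAt 0 (hasDerivAt_mul hc))
    (hasDerivAt_reG hc) (reG_pos ha hb hp).ne').const_mul C

lemma derivKahler_im {j k : Fin 4} (C : ℝ)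
    (hg : ∀ q, OnCover q → kahlerForm a b h q (frame j q) (frame k q) =
      C * ((q.2.1 * q.2.2).im / reG a b q ^ 2)) :
    derivKahler a b h p i j k =
      C * (((frame i p).2.1 * p.2.2 + p.2.1 * (frame i p).2.2).im / reG a b p ^ 2 -
        2 * (p.2.1 * p.2.2).im * dReG a b p (frame i p) / reG a b p ^ 3) := by
  refine derivKahler_eq ha hb hp hh hg fun c hc0 hc => ?_
  subst hc0
  exact (hasDerivAt_div_sq (Complex.imCLM.hasFDerivAt.comp_hasDerivAt 0 (hasDerivAt_mul hc))
    (hasDerivAt_reG hc) (reG_pos ha hb hp).ne').const_mul C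

lemma derivKahler_two_three :
    derivKahler a b h p i 2 3 = -dReG a b p (frame i p) / reG a b p ^ 2 := by
  refine derivKahler_eq ha hb hp hh (fun q hq => kahlerForm_two_three h hq) fun c hc0 hc => ?_
  subst hc0
  simp only [one_div]
  exact (hasDerivAt_reG hc).inv (reG_pos ha hb hp).ne'

end Deriv

end

/-! ### The exterior derivative of `Ω` and the Lee form -/

section

/-- A 3-form in dimension four has four independent components. -/
lemma eq_zero_of_alternating {T : Fin 4 → Fin 4 → Fin 4 → ℝ} (h₁ : ∀ i j k, T i j k = -T j i k)
    (h₂ : ∀ i j k, T i j k = -T i k j) (h012 : T 0 1 2 = 0) (h013 : T 0 1 3 = 0)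
    (h023 : T 0 2 3 = 0) (h123 : T 1 2 3 = 0) (i j k : Fin 4) : T i j k = 0 := by
  have e1 := h₁ i j k
  have e2 := h₂ i j k
  have e3 := h₂ j i k
  have e4 := h₁ i k j
  have e5 := h₁ j k i
  revert e1 e2 e3 e4 e5
  fin_cases i <;> fin_cases j <;> fin_cases k <;> simp <;> intros <;> linarith

variable {a b : ℂ} {h : ℝ → ℝ} {p : V}

lemma derivKahler_antisymm (i j k : Fin 4) :
    derivKahler a b h p i j k = -derivKahler a b h p i k j := by
  have : (fun q => kahlerForm a b h q (frame j q) (frame k q)) =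
      fun q => -kahlerForm a b h q (frame k q) (frame j q) :=
    funext fun q => kahlerForm_antisymm a b h q _ _
  rw [derivKahler, this, fderiv_fun_neg]
  rfl

lemma bracketKahler_antisymm (i j k : Fin 4) :
    bracketKahler a b h p i j k = -bracketKahler a b h p j i k := by
  rw [bracketKahler, VectorField.lieBracket_swap, kahlerForm_neg_left, bracketKahler]

lemma dKahler_antisymm_left (i j k : Fin 4) :
    dKahler a b h p i j k = -dKahler a b h p j i k := by
  simp only [dKahler]
  rw [derivKahler_antisymm k i j, bracketKahler_antisymm i j k]
  ring

lemma dKahler_antisymm_right (i j k : Fin 4) :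
    dKahler a b h p i j k = -dKahler a b h p i k j := by
  simp only [dKahler]
  rw [derivKahler_antisymm i j k, bracketKahler_antisymm j k i]
  ring

lemma bracketKahler_zero_left (j k : Fin 4) : bracketKahler a b h p 0 j k = 0 := by
  rw [bracketKahler, lieBracket_frame_zero]
  simpa using kahlerForm_smul_left a b h p 0 (frame k p) 0

section

variable (ha : 0 < a.re) (hb : 0 < b.re) (hp : OnCover p) (hh : DifferentiableAt ℝ h p.1)
include ha hb hp hh

lemma dKahler_zero_one_two :
    dKahler a b h p 0 1 2 = -h p.1 * kahlerForm a b h p (frame 1 p) (frame 2 p) := by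
  have hR0 := (reG_pos ha hb hp).ne'
  have hpi := Real.pi_ne_zero
  simp only [dKahler, bracketKahler_zero_left]
  rw [derivKahler_re ha hb hp hh 0 _ fun q hq => kahlerForm_one_two h hq,
    derivKahler_re ha hb hp hh 1 _ fun q hq => kahlerForm_zero_two h ha hb hq,
    derivKahler_zero_one ha hb hp hh, bracketKahler, lieBracket_frame_one_two,
    kahlerForm_smul_left, kahlerForm_antisymm, kahlerForm_zero_three h ha hb hp,
    kahlerForm_one_two h hp]
  simp [frame, dReG]
  field_simp
  ring

lemma dKahler_zero_one_three :
    dKahler a b h p 0 1 3 = -h p.1 * kahlerForm a b h p (frame 1 p) (frame 3 p) := by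
  have hR0 := (reG_pos ha hb hp).ne'
  have hpi := Real.pi_ne_zero
  simp only [dKahler, bracketKahler_zero_left]
  rw [derivKahler_im ha hb hp hh 0 _ fun q hq => kahlerForm_one_three h hq,
    derivKahler_im ha hb hp hh 1 _ fun q hq => kahlerForm_zero_three h ha hb hq,
    derivKahler_zero_one ha hb hp hh, bracketKahler, lieBracket_frame_one_three,
    kahlerForm_smul_left, kahlerForm_antisymm, kahlerForm_zero_two h ha hb hp,
    kahlerForm_one_three h hp]
  simp [frame, dReG]
  field_simp
  ring

lemma dKahler_zero_two_three :
    dKahler a b h p 0 2 3 = -h p.1 * kahlerForm a b h p (frame 2 p) (frame 3 p) := by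
  have hR0 := (reG_pos ha hb hp).ne'
  have hpi := Real.pi_ne_zero
  simp only [dKahler, bracketKahler_zero_left]
  rw [derivKahler_two_three ha hb hp hh,
    derivKahler_im ha hb hp hh 2 _ fun q hq => kahlerForm_zero_three h ha hb hq,
    derivKahler_re ha hb hp hh 3 _ fun q hq => kahlerForm_zero_two h ha hb hq,
    bracketKahler, lieBracket_frame_two_three,
    kahlerForm_smul_left, kahlerForm_antisymm, kahlerForm_zero_one h ha hb hp,
    kahlerForm_two_three h hp]
  simp [frame, dReG]
  field_simp
  ring

lemma dKahler_one_two_three : dKahler a b h p 1 2 3 = 0 := by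
  have hR0 := (reG_pos ha hb hp).ne'
  simp only [dKahler]
  rw [derivKahler_two_three ha hb hp hh,
    derivKahler_im ha hb hp hh 2 _ fun q hq => kahlerForm_one_three h hq,
    derivKahler_re ha hb hp hh 3 _ fun q hq => kahlerForm_one_two h hq,
    bracketKahler, bracketKahler, bracketKahler, lieBracket_frame_two_three,
    lieBracket_frame_one_two, lieBracket_frame_one_three,
    kahlerForm_smul_left, kahlerForm_smul_left, kahlerForm_smul_left, kahlerForm_self,
    kahlerForm_self, kahlerForm_self]
  simp [frame, dReG]
  field_simp
  ring

/-- The Lee form of `g^h` is `-h dθ`. -/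
lemma isLeeFormAt_neg_smul_fst :
    IsLeeFormAt a b h p (-h p.1 • LinearMap.fst ℝ ℝ (ℂ × ℂ)) := by
  intro i j k
  rw [← sub_eq_zero]
  refine eq_zero_of_alternating (T := fun i j k => dKahler a b h p i j k -
    ((-h p.1 • LinearMap.fst ℝ ℝ (ℂ × ℂ)) (frame i p) * kahlerForm a b h p (frame j p) (frame k p)
      - (-h p.1 • LinearMap.fst ℝ ℝ (ℂ × ℂ)) (frame j p) *
        kahlerForm a b h p (frame i p) (frame k p)
      + (-h p.1 • LinearMap.fst ℝ ℝ (ℂ × ℂ)) (frame k p) *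
        kahlerForm a b h p (frame i p) (frame j p))) ?_ ?_ ?_ ?_ ?_ ?_ i j k
  · intro i j k
    rw [dKahler_antisymm_left, kahlerForm_antisymm a b h p (frame i p) (frame j p)]
    ring
  · intro i j k
    rw [dKahler_antisymm_right, kahlerForm_antisymm a b h p (frame j p) (frame k p)]
    ring
  · rw [dKahler_zero_one_two ha hb hp hh]; simp [frame]
  · rw [dKahler_zero_one_three ha hb hp hh]; simp [frame]
  · rw [dKahler_zero_two_three ha hb hp hh]; simp [frame]
  · rw [dKahler_one_two_three ha hb hp hh]; simp [frame]

end

/-- Wedging 1-forms with `Ω` is injective because the Pfaffian of `Ω` in the frame is `h / (2R²) ≠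
0`. The four final combinations are Pfaffian cofactor expansions. -/
lemma IsLeeFormAt.eq_on_frame (ha : 0 < a.re) (hb : 0 < b.re) (hp : OnCover p) (hpos : 0 < h p.1)
    {l l' : V →ₗ[ℝ] ℝ} (hl : IsLeeFormAt a b h p l) (hl' : IsLeeFormAt a b h p l') (i : Fin 4) :
    l (frame i p) = l' (frame i p) := by
  have hR := reG_pos ha hb hp
  have hpi := Real.pi_pos
  set K := fun j k => kahlerForm a b h p (frame j p) (frame k p) with hK
  have hPf : K 0 1 * K 2 3 - K 0 2 * K 1 3 + K 0 3 * K 1 2 ≠ 0 := by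
    have : K 0 1 * K 2 3 - K 0 2 * K 1 3 + K 0 3 * K 1 2 = h p.1 / (2 * reG a b p ^ 2) := by
      simp only [hK, kahlerForm_zero_one h ha hb hp, kahlerForm_zero_two h ha hb hp,
        kahlerForm_zero_three h ha hb hp, kahlerForm_one_two h hp, kahlerForm_one_three h hp,
        kahlerForm_two_three h hp]
      field_simp
      ring
    rw [this]
    positivity
  have e (i j k : Fin 4) : (l (frame i p) - l' (frame i p)) * K j k -
      (l (frame j p) - l' (frame j p)) * K i k + (l (frame k p) - l' (frame k p)) * K i j = 0 := by
    linear_combination hl' i j k - hl i j k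
  have e1 := e 0 1 2
  have e2 := e 0 1 3
  have e3 := e 0 2 3
  have e4 := e 1 2 3
  refine sub_eq_zero.mp ((mul_eq_zero.mp ?_).resolve_right hPf)
  fin_cases i <;> dsimp only [Fin.reduceFinMk, Fin.zero_eta, Fin.mk_one, Fin.isValue]
  · linear_combination K 0 1 * e3 - K 0 2 * e2 + K 0 3 * e1
  · linear_combination K 0 1 * e4 - K 1 2 * e2 + K 1 3 * e1
  · linear_combination K 0 2 * e4 - K 1 2 * e3 + K 2 3 * e1
  · linear_combination K 0 3 * e4 - K 1 3 * e3 + K 2 3 * e2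

lemma mem_tangent_iff {X : V} :
    X ∈ tangent p ↔ ∃ s : Fin 4 → ℝ, ∑ i, s i • frame i p = X :=
  Submodule.mem_span_range_iff_exists_fun ℝ

/-- The choice made by `Classical.epsilon` is pinned down only on the span of the frame, hence the
restriction to tangent vectors. -/
lemma leeForm_apply (ha : 0 < a.re) (hb : 0 < b.re) (hp : OnCover p)
    (hh : DifferentiableAt ℝ h p.1) (hpos : 0 < h p.1) {X : V} (hX : X ∈ tangent p) :
    leeForm a b h p X = -h p.1 * X.1 := by
  have h0 := isLeeFormAt_neg_smul_fst ha hb hp hh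
  have h1 : IsLeeFormAt a b h p (leeForm a b h p) := Classical.epsilon_spec ⟨_, h0⟩
  obtain ⟨s, rfl⟩ := mem_tangent_iff.mp hX
  have : leeForm a b h p (∑ i, s i • frame i p) =
      (-h p.1 • LinearMap.fst ℝ ℝ (ℂ × ℂ)) (∑ i, s i • frame i p) := by
    rw [map_sum, map_sum]
    exact Finset.sum_congr rfl fun i _ => by
      rw [map_smul, map_smul, h1.eq_on_frame ha hb hp hpos h0]
  rw [this]
  rfl

lemma mem_leeKernel_iff (ha : 0 < a.re) (hb : 0 < b.re) (hp : OnCover p)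
    (hh : DifferentiableAt ℝ h p.1) (hpos : 0 < h p.1) {X : V} :
    X ∈ leeKernel a b h p ↔ X ∈ tangent p ∧ X.1 = 0 := by
  refine and_congr_right fun hX => ?_
  rw [leeForm_apply ha hb hp hh hpos hX]
  simp [hpos.ne']

lemma frame_mem_tangent (i : Fin 4) : frame i p ∈ tangent p := Submodule.subset_span ⟨i, rfl⟩

end

/-! ### The plane field `ℱ^⊥ ⊕ Jℱ^⊥` -/

section

variable {a b : ℂ} {h : ℝ → ℝ} {p : V}

lemma sum_frame (s : Fin 4 → ℝ) :
    ∑ i, s i • frame i p = (s 0,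
      s 1 * (Complex.I * p.2.1) - (s 2 + s 3 * Complex.I) * (starRingEnd ℂ) p.2.2,
      s 1 * (Complex.I * p.2.2) + (s 2 + s 3 * Complex.I) * (starRingEnd ℂ) p.2.1) := by
  rw [Fin.sum_univ_four]
  refine Prod.ext ?_ (Prod.ext ?_ ?_) <;> simp [frame] <;> ring

lemma mul_I_mem_tangent (hp : OnCover p) (r κ μ : ℝ) :
    ((r, κ * (Complex.I * p.2.1), μ * (Complex.I * p.2.2)) : V) ∈ tangent p := by
  have h1 := hp.mul_conj_add
  -- The coefficients are the inner products of the vector with the orthonormal frame.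
  refine mem_tangent_iff.mpr ⟨![r, κ * ‖p.2.1‖ ^ 2 + μ * ‖p.2.2‖ ^ 2,
    ((μ - κ : ℝ) * (Complex.I * (p.2.1 * p.2.2))).re,
    ((μ - κ : ℝ) * (Complex.I * (p.2.1 * p.2.2))).im], ?_⟩
  rw [sum_frame]
  refine Prod.ext rfl (Prod.ext ?_ ?_)
  all_goals
    simp only [Matrix.cons_val, Complex.re_add_im]
    push_cast
    rw [← Complex.mul_conj', ← Complex.mul_conj']
  · linear_combination κ * Complex.I * p.2.1 * h1
  · linear_combination μ * Complex.I * p.2.2 * h1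

/-- Orthogonality to `frame 2` forces the `e₃`, `e₄` part of `X` to be a real multiple of `iξ₁ξ₂`;
such an `X` moves each `ξ_j` along its own circle. -/
lemma re_conj_mul_eq_zero (ha : 0 < a.re) (hb : 0 < b.re) (hp : OnCover p) {X : V}
    (hX : X ∈ tangent p) (hX2 : herm a b h p X (frame 2 p) = 0) :
    ((starRingEnd ℂ) p.2.1 * X.2.1).re = 0 ∧ ((starRingEnd ℂ) p.2.2 * X.2.2).re = 0 := by
  obtain ⟨s, rfl⟩ := mem_tangent_iff.mp hX
  have hR := (reG_pos ha hb hp).ne'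
  have hRc : ((reG a b p : ℝ) : ℂ) ≠ 0 := by exact_mod_cast hR
  have hz : ∃ κ : ℝ, (s 2 + s 3 * Complex.I : ℂ) = κ * (Complex.I * (p.2.1 * p.2.2)) := by
    -- Solving `x₁ g₁₂ + x₂ g₂₂ = 0` for `s 2 + s 3 * I`: the two terms in `s 0 * (a.re - b.re) /
    -- (2π)` cancel, and what remains is this real factor times `iξ₁ξ₂`.
    refine ⟨s 0 * ((a.im - b.im) / (2 * Real.pi)) - (s 0 * ((‖p.2.1‖ ^ 2 * a.im +
      ‖p.2.2‖ ^ 2 * b.im) / (2 * Real.pi)) + s 1) * (a.re - b.re) / reG a b p, ?_⟩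
    simp only [Fin.sum_univ_four, herm_add_left, herm_smul_left] at hX2
    simp only [herm_frame_two a b h hp, coords_frame_one a b hp, coords_frame_two a b hp,
      coords_frame_three a b hp, coords_frame_zero_zero a b hp,
      coords_frame_zero_one a b hp] at hX2
    generalize (‖p.2.1‖ ^ 2 * a.im + ‖p.2.2‖ ^ 2 * b.im) / (2 * Real.pi) = c at *
    generalize (a.im - b.im) / (2 * Real.pi) = l' at *
    have hpi : (Real.pi : ℂ) ≠ 0 := by exact_mod_cast Real.pi_ne_zero
    simp [metricMatrix] at hX2
    push_cast
    generalize (reG a b p : ℂ) = R at *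
    field_simp at hX2 ⊢
    refine mul_left_cancel₀ (mul_ne_zero two_ne_zero hpi) ?_
    linear_combination hX2 + s 0 * R * p.2.1 * p.2.2 * (a.re - b.re) * Complex.I_sq
  obtain ⟨κ, hκ⟩ := hz
  rw [sum_frame]
  simp only [hκ]
  have e1 : (starRingEnd ℂ) p.2.1 * (s 1 * (Complex.I * p.2.1) -
      κ * (Complex.I * (p.2.1 * p.2.2)) * (starRingEnd ℂ) p.2.2) =
      Complex.I * (((s 1 - κ * ‖p.2.2‖ ^ 2) * ‖p.2.1‖ ^ 2 : ℝ) : ℂ) := by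
    push_cast
    rw [← Complex.mul_conj', ← Complex.mul_conj']
    ring
  have e2 : (starRingEnd ℂ) p.2.2 * (s 1 * (Complex.I * p.2.2) +
      κ * (Complex.I * (p.2.1 * p.2.2)) * (starRingEnd ℂ) p.2.1) =
      Complex.I * (((s 1 + κ * ‖p.2.1‖ ^ 2) * ‖p.2.2‖ ^ 2 : ℝ) : ℂ) := by
    push_cast
    rw [← Complex.mul_conj', ← Complex.mul_conj']
    ring
  rw [e1, e2]
  constructor <;> rw [Complex.I_mul_re, Complex.ofReal_im, neg_zero]

section

variable (ha : 0 < a.re) (hb : 0 < b.re) (hp : OnCover p)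
  (hh : DifferentiableAt ℝ h p.1) (hpos : 0 < h p.1)
include ha hb hp hh hpos

/-- Real orthogonality to `frame 2` and to `frame 3 = J frame 2` gives the real and imaginary parts.
-/
lemma herm_eq_zero_of_mem_leePerp {X : V} (hX : X ∈ leePerp a b h p) :
    herm a b h p X (frame 2 p) = 0 := by
  have h2 := hX.2 (frame 2 p) ((mem_leeKernel_iff ha hb hp hh hpos).mpr ⟨frame_mem_tangent 2, rfl⟩)
  have h3 := hX.2 (frame 3 p) ((mem_leeKernel_iff ha hb hp hh hpos).mpr ⟨frame_mem_tangent 3, rfl⟩)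
  rw [metric] at h2
  rw [metric, herm_frame_three a b h hp] at h3
  apply Complex.ext
  · exact h2
  · simpa using h3

omit ha hb hp hh hpos in
lemma coords_eq_I_smul {X Y : V} (hXY : dF a b p Y = Complex.I • dF a b p X) :
    coords a b p Y = Complex.I • coords a b p X := by
  simp only [coords, hXY, ← Matrix.mulVec_smul]
  congr 1
  ext i; fin_cases i <;> simp

lemma herm_eq_zero_of_mem_jLeePerp {X : V} (hX : X ∈ jLeePerp a b h p) :
    herm a b h p X (frame 2 p) = 0 := by
  obtain ⟨-, Y, hY, hXY⟩ := hX
  have := herm_eq_zero_of_mem_leePerp ha hb hp hh hpos hY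
  rw [herm_eq] at this ⊢
  rw [coords_eq_I_smul hXY]
  simp only [Pi.smul_apply, smul_eq_mul]
  linear_combination Complex.I * this

lemma re_conj_mul_eq_zero_of_mem_leePlane {X : V} (hX : X ∈ leePlane a b h p) :
    ((starRingEnd ℂ) p.2.1 * X.2.1).re = 0 ∧ ((starRingEnd ℂ) p.2.2 * X.2.2).re = 0 := by
  induction hX using Submodule.span_induction with
  | mem X hX =>
    rcases hX with hX | hX
    · exact re_conj_mul_eq_zero ha hb hp hX.1 (herm_eq_zero_of_mem_leePerp ha hb hp hh hpos hX)
    · exact re_conj_mul_eq_zero ha hb hp hX.1 (herm_eq_zero_of_mem_jLeePerp ha hb hp hh hpos hX)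
  | zero => simp
  | add X Y _ _ hX hY =>
    simp only [Prod.snd_add, Prod.fst_add, mul_add, Complex.add_re, hX.1, hX.2, hY.1, hY.2]
    simp
  | smul r X _ hX =>
    simp only [Prod.smul_snd, Prod.smul_fst, mul_smul_comm, Complex.smul_re, hX.1, hX.2]
    simp

omit ha hb hh hpos in
lemma coords_horizontal (r : ℝ) :
    coords a b p (r, (-r * a.im / (2 * Real.pi) : ℝ) * (Complex.I * p.2.1),
      (-r * b.im / (2 * Real.pi) : ℝ) * (Complex.I * p.2.2)) =
    ![-Complex.I * ((r * reG a b p / (2 * Real.pi) : ℝ) : ℂ),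
      -((r * (a.re - b.re) / (2 * Real.pi) : ℝ) : ℂ) * (p.2.1 * p.2.2)] := by
  rw [coords_eq_of_onCover a b hp]
  have e (a z : ℂ) : (r : ℂ) * a / (2 * Real.pi) * z +
      ((-r * a.im / (2 * Real.pi) : ℝ) : ℂ) * (Complex.I * z) =
      r * a.re / (2 * Real.pi) * z := by
    conv_lhs => enter [1]; rw [← Complex.re_add_im a]
    push_cast
    ring
  simp only [e]
  congr 1
  · simp only [reG]
    push_cast
    rw [← Complex.mul_conj', ← Complex.mul_conj']
    ring
  · push_cast
    congr 1
    ring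

/-- The angular terms undo the rotation in `F`: the image under `dF` is `(r/2π)(Re a · z₁, Re b ·
z₂)`, with real factors. The product with `frame 1` is then purely imaginary, and those with `frame
2` and `frame 3` vanish. -/
lemma horizontal_mem_leePerp (r : ℝ) :
    ((r, (-r * a.im / (2 * Real.pi) : ℝ) * (Complex.I * p.2.1),
      (-r * b.im / (2 * Real.pi) : ℝ) * (Complex.I * p.2.2)) : V) ∈ leePerp a b h p := by
  refine ⟨mul_I_mem_tangent hp _ _ _, fun Y hY => ?_⟩
  obtain ⟨hYt, hY0⟩ := (mem_leeKernel_iff ha hb hp hh hpos).mp hY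
  obtain ⟨s, rfl⟩ := mem_tangent_iff.mp hYt
  have hs : s 0 = 0 := by rw [sum_frame] at hY0; exact hY0
  set X : V := (r, (-r * a.im / (2 * Real.pi) : ℝ) * (Complex.I * p.2.1),
      (-r * b.im / (2 * Real.pi) : ℝ) * (Complex.I * p.2.2)) with hX
  have hc := coords_horizontal (a := a) (b := b) hp r
  rw [← hX] at hc
  have hRc : ((reG a b p : ℝ) : ℂ) ≠ 0 := by exact_mod_cast (reG_pos ha hb hp).ne'
  have h2 : herm a b h p X (frame 2 p) = 0 := by
    rw [herm_frame_two a b h hp, hc]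
    simp [metricMatrix]
    field_simp
    linear_combination -(r * p.2.1 * p.2.2 * (a.re - b.re)) * Complex.I_sq
  have h3 : herm a b h p X (frame 3 p) = 0 := by rw [herm_frame_three a b h hp, h2, mul_zero]
  have h1 : (herm a b h p X (frame 1 p)).re = 0 := by
    rw [herm_frame_one a b h hp, hc]
    have : p.2.1 * p.2.2 * (starRingEnd ℂ) (Complex.I * p.2.1 * p.2.2) =
      -Complex.I * ((‖p.2.1‖ ^ 2 * ‖p.2.2‖ ^ 2 : ℝ) : ℂ) := by
      push_cast
      rw [← Complex.mul_conj', ← Complex.mul_conj']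
      simp
      ring
    simp only [metricMatrix, Matrix.of_apply, Matrix.cons_val', Matrix.cons_val_zero,
      Matrix.cons_val_fin_one, Matrix.cons_val_one]
    have e (x m l L s n : ℝ) (Q Q' : ℂ) (hQ : Q * Q' = -Complex.I * (n : ℂ)) :
        -Complex.I * (x : ℂ) * (m : ℂ) + -(l : ℂ) * Q * (Q' * (L : ℂ) / (s : ℂ)) =
          Complex.I * ((l * n * L / s - x * m : ℝ) : ℂ) := by
      push_cast
      linear_combination -(l * L / s : ℂ) * hQ
    rw [e _ _ _ _ _ _ _ _ this, Complex.I_mul_re, Complex.ofReal_im, neg_zero]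
  rw [metric, ← herm_conj, Complex.conj_re]
  simp only [Fin.sum_univ_four, herm_add_left, herm_smul_left, hs, Complex.ofReal_zero, zero_mul,
    zero_add, Complex.add_re, Complex.re_ofReal_mul]
  rw [← herm_conj a b h p X, ← herm_conj a b h p X, ← herm_conj a b h p X, h2, h3,
    Complex.conj_re, h1]
  simp

lemma vertical_mem_jLeePerp (s : ℝ) :
    (((0 : ℝ), (s * a.re : ℝ) * (Complex.I * p.2.1), (s * b.re : ℝ) * (Complex.I * p.2.2)) : V) ∈
      jLeePerp a b h p := by
  -- `J` of the horizontal vector of parameter `r` is vertical of parameter `r / 2π`.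
  refine ⟨mul_I_mem_tangent hp _ _ _, _,
    horizontal_mem_leePerp ha hb hp hh hpos (2 * Real.pi * s), ?_⟩
  have hpi : (Real.pi : ℂ) ≠ 0 := by exact_mod_cast Real.pi_ne_zero
  have e (a z : ℂ) : ((0 : ℝ) : ℂ) * a / (2 * Real.pi) * z + (s * a.re : ℝ) * (Complex.I * z) =
      Complex.I * (((2 * Real.pi * s : ℝ) : ℂ) * a / (2 * Real.pi) * z +
        (-(2 * Real.pi * s) * a.im / (2 * Real.pi) : ℝ) * (Complex.I * z)) := by
    conv_rhs => enter [2, 1]; rw [← Complex.re_add_im a]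
    push_cast
    field_simp
    ring
  rw [dF_apply, dF_apply]
  simp only [e, Prod.smul_mk, smul_eq_mul]
  refine Prod.ext ?_ ?_ <;> simp only <;> ring

lemma mem_leePlane (s t : ℝ) :
    ((t, (s * a.re - t * a.im / (2 * Real.pi) : ℝ) * (Complex.I * p.2.1),
      (s * b.re - t * b.im / (2 * Real.pi) : ℝ) * (Complex.I * p.2.2)) : V) ∈
      leePlane a b h p := by
  have h1 : _ ∈ leePlane a b h p :=
    Submodule.subset_span (Or.inl (horizontal_mem_leePerp ha hb hp hh hpos t))
  have h2 : _ ∈ leePlane a b h p :=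
    Submodule.subset_span (Or.inr (vertical_mem_jLeePerp ha hb hp hh hpos s))
  convert add_mem h1 h2 using 1
  refine Prod.ext ?_ (Prod.ext ?_ ?_)
  · simp
  all_goals
    simp only [Prod.mk_add_mk]
    push_cast
    ring

end

end

/-! ### Condition (R) and density of angles -/

section

variable {a b : ℂ}

lemma exp_zpow_eq_exp_zpow_iff (a b : ℂ) (m n : ℤ) :
    Complex.exp a ^ m = Complex.exp b ^ n ↔
      ∃ K : ℤ, m * a.re = n * b.re ∧ m * a.im = n * b.im + 2 * Real.pi * K := by
  rw [← Complex.exp_int_mul, ← Complex.exp_int_mul, Complex.exp_eq_exp_iff_exists_int]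
  refine exists_congr fun K => ?_
  rw [Complex.ext_iff]
  simp [mul_comm]

lemma isRational_iff (hb : 0 < b.re) :
    IsRational a b ↔
      ∃ m n : ℤ, (m ≠ 0 ∨ n ≠ 0) ∧ Complex.exp a ^ m = Complex.exp b ^ n := by
  have hpi := Real.pi_ne_zero
  constructor
  · rintro ⟨k, l, p, q, hk, hq, -, -, h1, h2⟩
    -- Multiplying `k arg α - l arg β = π p / q` by `2q` gives an integer multiple of `2π`.
    refine ⟨2 * q * k, 2 * q * l, Or.inl (by positivity), ?_⟩
    have hk' : (k : ℝ) ≠ 0 := by exact_mod_cast hk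
    have hq' : (q : ℝ) ≠ 0 := by exact_mod_cast hq
    rw [div_eq_div_iff hpi hq'] at h1
    rw [div_eq_div_iff hb.ne' hk'] at h2
    refine (exp_zpow_eq_exp_zpow_iff a b _ _).mpr ⟨p, ?_, ?_⟩
    · push_cast
      linear_combination 2 * q * h2
    · push_cast
      linear_combination 2 * h1
  · rintro ⟨m, n, hmn, hE⟩
    obtain ⟨K, h1, h2⟩ := (exp_zpow_eq_exp_zpow_iff a b _ _).mp hE
    have hm : m ≠ 0 := by
      rintro rfl
      have : (n : ℝ) = 0 := by simpa [hb.ne'] using h1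
      simp_all
    have hg : 0 < Int.gcd n m := Int.gcd_pos_of_ne_zero_right _ hm
    obtain ⟨l, k, hlk, hl, hk⟩ := Int.exists_gcd_one hg
    set d := Int.gcd n m
    have hd : (d : ℝ) ≠ 0 := by exact_mod_cast hg.ne'
    have hk0 : k ≠ 0 := by
      rintro rfl
      simp at hk
      exact hm hk
    have hk' : (k : ℝ) ≠ 0 := by exact_mod_cast hk0
    rw [hl, hk] at h1 h2
    push_cast at h1 h2
    -- Dividing `m arg α - n arg β = 2πK` by `d = gcd(n, m)` shows that `p / q` must be `2K / d` in
    -- lowest terms.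
    refine ⟨k, l, (2 * K / d : ℚ).num, (2 * K / d : ℚ).den, hk0, by simp, ?_,
      Int.isCoprime_iff_gcd_eq_one.mpr hlk, ?_, ?_⟩
    · exact Rat.isCoprime_num_den _
    · have : (((2 * K / d : ℚ).num : ℝ) / (((2 * K / d : ℚ).den : ℤ) : ℝ)) = 2 * K / d := by
        have := Rat.num_div_den (2 * K / d : ℚ)
        exact_mod_cast congrArg (fun x : ℚ => (x : ℝ)) this
      rw [this, div_eq_div_iff hpi hd]
      linear_combination h2
    · rw [div_eq_div_iff hb.ne' hk']
      refine mul_right_cancel₀ hd ?_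
      linear_combination h1

/-- These are the returns of a leaf to fixed `θ` and `ξ₁`, read on `arg ξ₂`: `l`, `m`, `n` count
turns of `ξ₂`, `ξ₁` and `θ`. -/
lemma dense_angles (ha : 0 < a.re) (hb : 0 < b.re) (hR : ¬ IsRational a b) (x : ℝ) :
    x ∈ closure {y : ℝ | ∃ l m n : ℤ, y = l * (2 * Real.pi) + m * (2 * Real.pi * b.re / a.re) +
      n * ((b.re * a.im - a.re * b.im) / a.re)} := by
  have hpi := Real.pi_ne_zero
  set H : AddSubgroup ℝ := AddSubgroup.zmultiples (2 * Real.pi) ⊔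
    AddSubgroup.zmultiples (2 * Real.pi * b.re / a.re) ⊔
    AddSubgroup.zmultiples ((b.re * a.im - a.re * b.im) / a.re) with hH
  have hsub : (H : Set ℝ) ⊆ {y : ℝ | ∃ l m n : ℤ, y = l * (2 * Real.pi) +
      m * (2 * Real.pi * b.re / a.re) + n * ((b.re * a.im - a.re * b.im) / a.re)} := by
    intro y hy
    obtain ⟨u, hu, w, ⟨n, rfl⟩, rfl⟩ := AddSubgroup.mem_sup.mp hy
    obtain ⟨u, ⟨l, rfl⟩, w, ⟨m, rfl⟩, rfl⟩ := AddSubgroup.mem_sup.mp hu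
    exact ⟨l, m, n, by simp⟩
  refine closure_mono hsub ?_
  -- If `H = ℤg`, the multiples `N`, `M`, `K` of `g` giving the three generators satisfy `M a = N b
  -- + 2πiK`, against the hypothesis.
  rcases AddSubgroup.dense_or_cyclic H with hd | ⟨g, hg⟩
  · exact hd x
  · exfalso
    rw [← AddSubgroup.zmultiples_eq_closure] at hg
    have h1 : 2 * Real.pi ∈ H :=
      AddSubgroup.mem_sup_left (AddSubgroup.mem_sup_left (AddSubgroup.mem_zmultiples (2 * Real.pi)))
    have h2 : 2 * Real.pi * b.re / a.re ∈ H :=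
      AddSubgroup.mem_sup_left (AddSubgroup.mem_sup_right
        (AddSubgroup.mem_zmultiples (2 * Real.pi * b.re / a.re)))
    have h3 : (b.re * a.im - a.re * b.im) / a.re ∈ H :=
      AddSubgroup.mem_sup_right (AddSubgroup.mem_zmultiples ((b.re * a.im - a.re * b.im) / a.re))
    rw [hg] at h1 h2 h3
    obtain ⟨N, hN⟩ := h1
    obtain ⟨M, hM⟩ := h2
    obtain ⟨K, hK⟩ := h3
    simp only [zsmul_eq_mul] at hN hM hK
    rw [eq_div_iff ha.ne'] at hM hK
    have hg0 : g ≠ 0 := by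
      rintro rfl
      simp [hpi] at hN
    have hN0 : N ≠ 0 := by
      rintro rfl
      simp [hpi] at hN
    have e1 : (M : ℝ) * a.re = N * b.re := by
      refine mul_left_cancel₀ hg0 ?_
      linear_combination hM - b.re * hN
    refine hR ((isRational_iff hb).mpr ⟨M, N, Or.inr hN0,
      (exp_zpow_eq_exp_zpow_iff a b _ _).mpr ⟨K, e1, ?_⟩⟩)
    refine mul_left_cancel₀ ha.ne' ?_
    linear_combination a.im * e1 - (N : ℝ) * hK + K * a.re * hN

/-! ### Leaves and their closures -/

lemma exists_eq_exp_mul {z w : ℂ} (hzw : ‖z‖ = ‖w‖) :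
    ∃ φ : ℝ, z = Complex.exp (φ * Complex.I) * w := by
  by_cases hw : w = 0
  · subst hw
    exact ⟨0, by simpa using hzw⟩
  · have : ‖z / w‖ = 1 := by rw [norm_div, hzw, div_self (norm_ne_zero_iff.mpr hw)]
    obtain ⟨φ, hφ⟩ := (Complex.norm_eq_one_iff _).mp this
    exact ⟨φ, by rw [hφ, div_mul_cancel₀ _ hw]⟩

variable {h : ℝ → ℝ}

lemma sq_norm_eq_of_inner_deriv_eq_zero {f f' : ℝ → ℂ} (hf : ∀ t, HasDerivAt f (f' t) t)
    (h0 : ∀ t, ((starRingEnd ℂ) (f t) * f' t).re = 0) (s t : ℝ) : ‖f s‖ = ‖f t‖ := by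
  have hd (t : ℝ) : HasDerivAt (fun t => ‖f t‖ ^ 2) 0 t := by
    refine (HasDerivAt.norm_sq (hf t)).congr_deriv ?_
    rw [Complex.inner, mul_comm (f' t), h0, mul_zero]
  have := is_const_of_deriv_eq_zero (fun t => (hd t).differentiableAt) (fun t => (hd t).deriv) s t
  exact (sq_eq_sq₀ (norm_nonneg _) (norm_nonneg _)).mp this

section

variable (ha : 0 < a.re) (hb : 0 < b.re) (hh : Differentiable ℝ h) (hpos : ∀ t, 0 < h t)
include ha hb hh hpos

lemma leaf_subset (P : S1 × S3) : leaf a b h P ⊆ (Set.univ : Set S1) ×ˢ torus P.2 := by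
  rintro Q ⟨c, hc, hon, htan, ⟨-, h0⟩, -, h1⟩
  have hcd (t : ℝ) : HasDerivAt c (deriv c t) t :=
    (hc.differentiable one_ne_zero t).hasDerivAt
  have hz (t : ℝ) :=
    re_conj_mul_eq_zero_of_mem_leePlane ha hb (hon t) (hh _) (hpos _) (htan t)
  have e1 := sq_norm_eq_of_inner_deriv_eq_zero (fun t => hasDerivAt_coord_one (hcd t))
    (fun t => (hz t).1) 1 0
  have e2 := sq_norm_eq_of_inner_deriv_eq_zero (fun t => hasDerivAt_coord_two (hcd t))
    (fun t => (hz t).2) 1 0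
  simp only [h0, h1] at e1 e2
  exact ⟨trivial, e1, e2⟩

/-- A straight segment in the coordinates `(θ, arg ξ₁, arg ξ₂)`; its velocity is one of the vectors
of `mem_leePlane`, with constant `s` and `t`. -/
lemma mem_leaf {P Q : S1 × S3} {θ : ℝ} (s t : ℝ) (hθ : (θ : S1) = P.1)
    (hQ : ((θ + t : ℝ) : S1) = Q.1)
    (hQ1 : Complex.exp ((s * a.re - t * a.im / (2 * Real.pi) : ℝ) * Complex.I) * P.2.1.1 = Q.2.1.1)
    (hQ2 : Complex.exp ((s * b.re - t * b.im / (2 * Real.pi) : ℝ) * Complex.I) * P.2.1.2 =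
      Q.2.1.2) :
    Q ∈ leaf a b h P := by
  set κ := s * a.re - t * a.im / (2 * Real.pi) with hκ
  set μ := s * b.re - t * b.im / (2 * Real.pi) with hμ
  let c : ℝ → V := fun τ => (θ + τ * t, Complex.exp ((τ * κ : ℝ) * Complex.I) * P.2.1.1,
    Complex.exp ((τ * μ : ℝ) * Complex.I) * P.2.1.2)
  have hcast (κ : ℝ) : ContDiff ℝ 1 fun τ : ℝ => ((τ * κ : ℝ) : ℂ) :=
    Complex.ofRealCLM.contDiff.comp (contDiff_id.mul contDiff_const)
  have hon (τ : ℝ) : OnCover (c τ) := by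
    simp only [OnCover, c, norm_mul, Complex.norm_exp_ofReal_mul_I, one_mul]
    exact P.2.2
  have hexp (κ τ : ℝ) (z : ℂ) :
      HasDerivAt (fun τ : ℝ => Complex.exp ((τ * κ : ℝ) * Complex.I) * z)
        (κ * (Complex.I * (Complex.exp ((τ * κ : ℝ) * Complex.I) * z))) τ := by
    have h1 : HasDerivAt (fun τ : ℝ => ((τ * κ : ℝ) : ℂ)) ((1 * κ : ℝ) : ℂ) τ :=
      ((hasDerivAt_id τ).mul_const κ).ofReal_comp
    refine ((h1.mul_const Complex.I).cexp.mul_const z).congr_deriv ?_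
    push_cast
    ring
  have hder (τ : ℝ) : deriv c τ =
      (t, (κ : ℂ) * (Complex.I * (c τ).2.1), (μ : ℂ) * (Complex.I * (c τ).2.2)) := by
    refine HasDerivAt.deriv (HasDerivAt.prodMk ?_ ((hexp κ τ _).prodMk (hexp μ τ _)))
    simpa using ((hasDerivAt_id τ).mul_const t).const_add θ
  refine ⟨c, ?_, hon, fun τ => ?_, ⟨by simp [c, hθ], by simp [c]⟩, ?_, ?_⟩
  · exact (contDiff_const.add (contDiff_id.mul contDiff_const)).prodMk
      ((((hcast κ).mul contDiff_const).cexp.mul contDiff_const).prodMk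
        (((hcast μ).mul contDiff_const).cexp.mul contDiff_const))
  · rw [hder]
    exact mem_leePlane ha hb (hon τ) (hh _) (hpos _) s t
  · simpa [c] using hQ
  · simp only [c, one_mul, hQ1, hQ2]

lemma subset_closure_leaf (hR : ¬ IsRational a b) (P : S1 × S3) :
    (Set.univ : Set S1) ×ˢ torus P.2 ⊆ closure (leaf a b h P) := by
  rintro Q ⟨-, hQ1, hQ2⟩
  obtain ⟨θ, hθ⟩ := QuotientAddGroup.mk_surjective P.1
  obtain ⟨θ', hθ'⟩ := QuotientAddGroup.mk_surjective Q.1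
  obtain ⟨φ₁, h1⟩ := exists_eq_exp_mul hQ1
  obtain ⟨φ₂, h2⟩ := exists_eq_exp_mul hQ2
  have hpi := Real.pi_ne_zero
  have hA := ha.ne'
  -- The rotation of `ξ₂` along the leaf when `θ` moves to `θ'` and `ξ₁` turns by exactly `φ₁`, with
  -- no extra turns.
  set y : ℝ := (φ₁ + (θ' - θ) * a.im / (2 * Real.pi)) * b.re / a.re -
    (θ' - θ) * b.im / (2 * Real.pi) with hy
  have hmem (x : ℝ) : ‖Q.2.1.1‖ ^ 2 + ‖Complex.exp ((y + x : ℝ) * Complex.I) * P.2.1.2‖ ^ 2 = 1 := by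
    rw [norm_mul, Complex.norm_exp_ofReal_mul_I, one_mul, hQ1]
    exact P.2.2
  let f : ℝ → S1 × S3 := fun x =>
    (Q.1, ⟨(Q.2.1.1, Complex.exp ((y + x : ℝ) * Complex.I) * P.2.1.2), hmem x⟩)
  have hf : Continuous f := by
    refine continuous_const.prodMk (Continuous.subtype_mk (continuous_const.prodMk ?_) _)
    fun_prop
  have hfQ : f (φ₂ - y) = Q := by
    refine Prod.ext rfl (Subtype.ext (Prod.ext rfl ?_))
    simp only [f, add_sub_cancel]
    exact h2.symm
  rw [← hfQ]
  refine map_mem_closure hf (dense_angles ha hb hR (φ₂ - y)) ?_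
  rintro x ⟨l, m, n, rfl⟩
  have hexp (x : ℝ) (l : ℤ) : Complex.exp ((x + l * (2 * Real.pi) : ℝ) * Complex.I) =
      Complex.exp (x * Complex.I) := by
    have := (Complex.exp_periodic.int_mul l) (x * Complex.I)
    rw [← this]
    push_cast
    congr 1
    ring
  -- Here `t` moves `θ` to `θ'` with `n` extra turns, and `s` is solved so that `ξ₁` turns by `φ₁ +
  -- 2πm`.
  refine mem_leaf ha hb hh hpos ((φ₁ + (θ' - θ + n * (2 * Real.pi)) * a.im / (2 * Real.pi) +
    m * (2 * Real.pi)) / a.re) (θ' - θ + n * (2 * Real.pi)) hθ ?_ ?_ ?_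
  · have e : θ + (θ' - θ + n * (2 * Real.pi)) = θ' + n • (2 * Real.pi) := by
      rw [zsmul_eq_mul]; ring
    rw [e, AddCircle.coe_add, AddCircle.coe_zsmul, AddCircle.coe_period, smul_zero, add_zero]
    exact hθ'
  · refine Eq.trans ?_ h1.symm
    rw [← hexp φ₁ m]
    congr 4
    field_simp
    ring
  · simp only [f]
    have e : y + (l * (2 * Real.pi) + m * (2 * Real.pi * b.re / a.re) +
        n * ((b.re * a.im - a.re * b.im) / a.re)) =
        y + (m * (2 * Real.pi * b.re / a.re) +
          n * ((b.re * a.im - a.re * b.im) / a.re)) + l * (2 * Real.pi) := by ring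
    rw [e, hexp, hy]
    congr 4
    field_simp
    ring

omit ha hb hh hpos in
lemma isClosed_torus (Ξ : S3) : IsClosed ((Set.univ : Set S1) ×ˢ torus Ξ) := by
  refine isClosed_univ.prod (IsClosed.inter ?_ ?_)
  · exact isClosed_eq (by fun_prop) continuous_const
  · exact isClosed_eq (by fun_prop) continuous_const

lemma closure_leaf (hR : ¬ IsRational a b) (P : S1 × S3) :
    closure (leaf a b h P) = (Set.univ : Set S1) ×ˢ torus P.2 :=
  (closure_minimal (leaf_subset ha hb hh hpos P) (isClosed_torus P.2)).antisymm
    (subset_closure_leaf ha hb hh hpos hR P)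

end

/-! ### Tori, circles and saturated components -/

lemma torus_eq_of_mem {ξ Ξ : S3} (hξ : ξ ∈ torus Ξ) : torus ξ = torus Ξ := by
  unfold torus
  rw [hξ.1, hξ.2]

lemma self_mem_torus (Ξ : S3) : Ξ ∈ torus Ξ := ⟨rfl, rfl⟩

lemma torus_of_snd_eq_zero {Ξ : S3} (hΞ : Ξ.1.2 = 0) : torus Ξ = {ξ : S3 | ξ.1.2 = 0} := by
  ext ξ
  simp only [torus, hΞ, norm_zero, norm_eq_zero, Set.mem_ofPred_eq, and_iff_right_iff_imp]
  intro h0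
  have h1 := ξ.2
  have h2 := Ξ.2
  rw [h0] at h1
  rw [hΞ] at h2
  exact (sq_eq_sq₀ (norm_nonneg _) (norm_nonneg _)).mp (add_right_cancel (h1.trans h2.symm))

lemma torus_of_fst_eq_zero {Ξ : S3} (hΞ : Ξ.1.1 = 0) : torus Ξ = {ξ : S3 | ξ.1.1 = 0} := by
  ext ξ
  simp only [torus, hΞ, norm_zero, norm_eq_zero, Set.mem_ofPred_eq, and_iff_left_iff_imp]
  intro h0
  have h1 := ξ.2
  have h2 := Ξ.2
  rw [h0] at h1
  rw [hΞ] at h2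
  exact (sq_eq_sq₀ (norm_nonneg _) (norm_nonneg _)).mp (add_left_cancel (h1.trans h2.symm))

/-- The two circles are the degenerate tori, so both kinds of component are treated uniformly. -/
lemma circlesAndTori_eq :
    circlesAndTori = {C | ∃ Ξ : S3, C = (Set.univ : Set S1) ×ˢ torus Ξ} := by
  ext C
  constructor
  · rintro ((rfl | rfl) | ⟨Ξ, -, rfl⟩)
    · exact ⟨⟨(1, 0), by simp⟩, by rw [torus_of_snd_eq_zero rfl]⟩
    · exact ⟨⟨(0, 1), by simp⟩, by rw [torus_of_fst_eq_zero rfl]⟩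
    · exact ⟨Ξ, rfl⟩
  · rintro ⟨Ξ, rfl⟩
    by_cases hΞ : Ξ.1.1 * Ξ.1.2 = 0
    · rcases mul_eq_zero.mp hΞ with h0 | h0
      · exact Or.inl (Or.inr (by rw [torus_of_fst_eq_zero h0]; rfl))
      · exact Or.inl (Or.inl (by rw [torus_of_snd_eq_zero h0]))
    · exact Or.inr ⟨Ξ, hΞ, rfl⟩

/-- A closed saturated set contains the closure of the leaf through each of its points, hence whole
tori; distinct tori are disjoint. -/
lemma isSaturatedComponent_iff (ha : 0 < a.re) (hb : 0 < b.re) (hh : Differentiable ℝ h)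
    (hpos : ∀ t, 0 < h t) (hR : ¬ IsRational a b) (C : Set (S1 × S3)) :
    IsSaturatedComponent a b h C ↔ ∃ Ξ : S3, C = (Set.univ : Set S1) ×ˢ torus Ξ := by
  have hsat (Ξ : S3) : IsSaturated a b h ((Set.univ : Set S1) ×ˢ torus Ξ) := fun P hP => by
    rw [← torus_eq_of_mem hP.2]
    exact leaf_subset ha hb hh hpos P
  have hmin {A : Set (S1 × S3)} (hA : IsClosed A) (hA' : IsSaturated a b h A) {P : S1 × S3}
      (hP : P ∈ A) : (Set.univ : Set S1) ×ˢ torus P.2 ⊆ A := by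
    rw [← closure_leaf ha hb hh hpos hR]
    exact closure_minimal (hA' P hP) hA
  constructor
  · rintro ⟨⟨⟨P, hP⟩, hC, hC'⟩, hm⟩
    have hsub := hmin hC hC' hP
    have hT : ((Set.univ : Set S1) ×ˢ torus P.2).Nonempty := ⟨P, trivial, self_mem_torus _⟩
    exact ⟨P.2, (hm ⟨hT, isClosed_torus _, hsat _⟩ hsub).antisymm hsub⟩
  · rintro ⟨Ξ, rfl⟩
    refine ⟨⟨⟨(0, Ξ), trivial, self_mem_torus _⟩, isClosed_torus _, hsat _⟩, ?_⟩
    rintro A ⟨⟨P, hP⟩, hA, hA'⟩ hAC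
    rw [← torus_eq_of_mem (hAC hP).2]
    exact hmin hA hA' hP

end

end HopfFoliation

theorem mainTheorem10 (α β a b : ℂ) (hβ : 1 < ‖β‖) (hαβ : ‖β‖ ≤ ‖α‖)
    (ha : Complex.exp a = α) (hb : Complex.exp b = β)
    (h : ℝ → ℝ) (h_smooth : ContDiff ℝ ∞ h) (h_per : Function.Periodic h (2 * Real.pi))
    (h_pos : ∀ t, 0 < h t) :
    (HopfFoliation.IsRational a b ↔ ∃ m n : ℤ, (m ≠ 0 ∨ n ≠ 0) ∧ α ^ m = β ^ n) ∧
    (¬ HopfFoliation.IsRational a b →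
      {C | HopfFoliation.IsSaturatedComponent a b h C} = HopfFoliation.circlesAndTori ∧
      {C | ∃ P, C = closure (HopfFoliation.leaf a b h P)} = HopfFoliation.circlesAndTori) := by
  have hα : 1 < ‖α‖ := hβ.trans_le hαβ
  subst ha hb
  rw [Complex.norm_exp, Real.one_lt_exp_iff] at hα hβ
  have hh : Differentiable ℝ h := h_smooth.differentiable (by simp)
  refine ⟨HopfFoliation.isRational_iff hβ, fun hR => ?_⟩
  rw [HopfFoliation.circlesAndTori_eq]
  constructor
  · ext C
    exact HopfFoliation.isSaturatedComponent_iff hα hβ hh h_pos hR C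
  · ext C
    simp only [HopfFoliation.closure_leaf hα hβ hh h_pos hR, Set.mem_ofPred_eq, Prod.exists,
      exists_const]
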